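/- Work in the two-sorted language of second-order arithmetic, with structures $M=(\mathbb N_M,\mathcal S_M,0,1,+,\cdot,<)$ whose first-order part $\mathbb N_M$ may be nonstandard and whose set quantifiers range over a nonempty family $\mathcal S_M$ of subsets of $\mathbb N_M$. $\mathsf{RCA}_0$ consists of the basic axioms of arithmetic, $\Sigma^0_1$ induction and $\Delta^0_1$ comprehension; $\mathsf{ACA}_0$ consists of the basic axioms, the induction axiom for sets and arithmetical comprehension. Finite strings are coded by numbers in the usual way. A tree is a set $T\subseteq\mathbb N^{<\mathbb N}$ closed under prefixes; it is finitely branching if every $\sigma\in T$ has only finitely many immediate successors in $T$. A partial function $h:\subseteq\mathbb N\to\mathbb N$ (whose domain exists as a set) is homogeneous for a string $\sigma$ if $\sigma(n)=h(n)$ for all $n\in\operatorname{dom}(h)$ with $n<|\sigma|$, and homogeneous for an infinite tree $T$ if $\{\sigma\in T: h \text{ is homogeneous for } \sigma\}$ is infinite; $h$ is infinite if $\operatorname{dom}(h)$ is. $\mathsf{RKL}$ (Ramsey-type König's lemma) is the statement "for every infinite, finitely branching tree $T\subseteq\mathbb N^{<\mathbb N}$ there is an infinite partial function that is homogeneous for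 $T$", and $\mathsf{RKL}_{2}$ is its restriction to infinite trees in which every string has at most two immediate successors. Theorem. $\mathsf{RCA}_0\vdash \mathsf{ACA}_0\leftrightarrow\mathsf{RKL}$, and likewise $\mathsf{RCA}_0\vdash \mathsf{ACA}_0\leftrightarrow\mathsf{RKL}_{2}$. That is, for every model $M$ of $\mathsf{RCA}_0$, $M$ is a model of $\mathsf{ACA}_0$ if and only if $M\models\mathsf{RKL}$, and $M$ is a model of $\mathsf{ACA}_0$ if and only if $M\models\mathsf{RKL}_{2}$. -/

import Mathlib

universe u

/-! ## The language of second-order arithmetic and its structures -/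

/-- A structure for the two-sorted language of second-order arithmetic. The first-order part `Num`
may be nonstandard; the second-order part is a nonempty collection of subsets of `Num`, over which
the set quantifiers range, and membership is true membership. -/
structure L2Structure where
  Num : Type u
  zero : Num
  one : Num
  add : Num → Num → Num
  mul : Num → Num → Num
  lt : Num → Num → Prop
  sets : Set (Set Num)
  sets_nonempty : sets.Nonempty

namespace L2Structure

instance (M : L2Structure.{u}) : Zero M.Num := ⟨M.zero⟩
instance (M : L2Structure.{u}) : One M.Num := ⟨M.one⟩
instance (M : L2Structure.{u}) : Add M.Num := ⟨M.add⟩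
instance (M : L2Structure.{u}) : Mul M.Num := ⟨M.mul⟩
instance (M : L2Structure.{u}) : LT M.Num := ⟨M.lt⟩

end L2Structure

/-- Numerical terms; `var i` is the number variable with de Bruijn index `i`. -/
inductive L2Term : Type where
  | var : ℕ → L2Term
  | zero : L2Term
  | one : L2Term
  | add : L2Term → L2Term → L2Term
  | mul : L2Term → L2Term → L2Term

/-- Arithmetical formulas: formulas of second-order arithmetic with no set quantifiers, but in
which set variables may occur free. Number quantifiers bind the de Bruijn index `0`.
In the bounded quantifiers `ballLT t φ` (for all `x < t`, `φ`) and `bexLT t φ` (there is `x < t`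
with `φ`) the term `t` is outside the scope of the quantifier. -/
inductive ArithFormula : Type where
  | eq : L2Term → L2Term → ArithFormula
  | lt : L2Term → L2Term → ArithFormula
  | mem : L2Term → ℕ → ArithFormula
  | not : ArithFormula → ArithFormula
  | and : ArithFormula → ArithFormula → ArithFormula
  | or : ArithFormula → ArithFormula → ArithFormula
  | imp : ArithFormula → ArithFormula → ArithFormula
  | ballLT : L2Term → ArithFormula → ArithFormula
  | bexLT : L2Term → ArithFormula → ArithFormula
  | all : ArithFormula → ArithFormula
  | ex : ArithFormula → ArithFormula

namespace ArithFormula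

/-- All number quantifiers of the formula are bounded. -/
def IsBounded : ArithFormula → Prop
  | eq _ _ => True
  | lt _ _ => True
  | mem _ _ => True
  | not φ => φ.IsBounded
  | and φ ψ => φ.IsBounded ∧ ψ.IsBounded
  | or φ ψ => φ.IsBounded ∧ ψ.IsBounded
  | imp φ ψ => φ.IsBounded ∧ ψ.IsBounded
  | ballLT _ φ => φ.IsBounded
  | bexLT _ φ => φ.IsBounded
  | all _ => False
  | ex _ => False

/-- `Σ⁰₁` formulas: `∃ m θ` with `θ` bounded. -/
def IsSigma01 (φ : ArithFormula) : Prop := ∃ θ : ArithFormula, θ.IsBounded ∧ φ = ex θ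

/-- `Π⁰₁` formulas: `∀ m θ` with `θ` bounded. -/
def IsPi01 (φ : ArithFormula) : Prop := ∃ θ : ArithFormula, θ.IsBounded ∧ φ = all θ

end ArithFormula

namespace L2Structure

/-- Extend an assignment of the number variables: index `0` gets `a`, the others are shifted. -/
def extend {M : L2Structure.{u}} (a : M.Num) (e : ℕ → M.Num) : ℕ → M.Num
  | 0 => a
  | i + 1 => e i

/-- The value of a term under an assignment. -/
def eval (M : L2Structure.{u}) (e : ℕ → M.Num) : L2Term → M.Num
  | .var i => e i
  | .zero => 0
  | .one => 1
  | .add s t => M.eval e s + M.eval e t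
  | .mul s t => M.eval e s * M.eval e t

/-- Satisfaction of an arithmetical formula, where `e` assigns elements of the first-order part to
the number variables and `E` assigns members of the second-order part to the set variables. -/
def Sat (M : L2Structure.{u}) (E : ℕ → M.sets) : ArithFormula → (ℕ → M.Num) → Prop
  | .eq s t, e => M.eval e s = M.eval e t
  | .lt s t, e => M.eval e s < M.eval e t
  | .mem t i, e => M.eval e t ∈ (E i : Set M.Num)
  | .not φ, e => ¬ M.Sat E φ e
  | .and φ ψ, e => M.Sat E φ e ∧ M.Sat E ψ e
  | .or φ ψ, e => M.Sat E φ e ∨ M.Sat E ψ e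
  | .imp φ ψ, e => M.Sat E φ e → M.Sat E ψ e
  | .ballLT t φ, e => ∀ a : M.Num, a < M.eval e t → M.Sat E φ (extend a e)
  | .bexLT t φ, e => ∃ a : M.Num, a < M.eval e t ∧ M.Sat E φ (extend a e)
  | .all φ, e => ∀ a : M.Num, M.Sat E φ (extend a e)
  | .ex φ, e => ∃ a : M.Num, M.Sat E φ (extend a e)

/-! ## The axiom systems -/

/-- The basic axioms of second-order arithmetic. -/
structure BasicAxioms (M : L2Structure.{u}) : Prop where
  succ_ne_zero : ∀ m : M.Num, m + 1 ≠ 0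
  succ_inj : ∀ m n : M.Num, m + 1 = n + 1 → m = n
  add_zero : ∀ m : M.Num, m + 0 = m
  add_succ : ∀ m n : M.Num, m + (n + 1) = (m + n) + 1
  mul_zero : ∀ m : M.Num, m * 0 = 0
  mul_succ : ∀ m n : M.Num, m * (n + 1) = (m * n) + m
  not_lt_zero : ∀ m : M.Num, ¬ m < 0
  lt_succ : ∀ m n : M.Num, m < n + 1 ↔ (m < n ∨ m = n)

/-- The induction axiom (a single axiom, for the sets of the second-order part). -/
def InductionAxiom (M : L2Structure.{u}) : Prop :=
  ∀ X ∈ M.sets, (0 : M.Num) ∈ X → (∀ n, n ∈ X → n + 1 ∈ X) → ∀ n, n ∈ X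

/-- The `Σ⁰₁` induction scheme, for formulas with arbitrary number and set parameters. -/
def Sigma01Induction (M : L2Structure.{u}) : Prop :=
  ∀ φ : ArithFormula, φ.IsSigma01 → ∀ (E : ℕ → M.sets) (e : ℕ → M.Num),
    M.Sat E φ (extend 0 e) →
    (∀ n : M.Num, M.Sat E φ (extend n e) → M.Sat E φ (extend (n + 1) e)) →
    ∀ n : M.Num, M.Sat E φ (extend n e)

/-- The `Δ⁰₁` comprehension scheme, for formulas with arbitrary number and set parameters. -/
def Delta01Comprehension (M : L2Structure.{u}) : Prop :=
  ∀ φ ψ : ArithFormula, φ.IsSigma01 → ψ.IsPi01 → ∀ (E : ℕ → M.sets) (e : ℕ → M.Num),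
    (∀ n : M.Num, M.Sat E φ (extend n e) ↔ M.Sat E ψ (extend n e)) →
    ∃ X ∈ M.sets, ∀ n : M.Num, n ∈ X ↔ M.Sat E φ (extend n e)

/-- The arithmetical comprehension scheme, with arbitrary number and set parameters. -/
def ArithmeticalComprehension (M : L2Structure.{u}) : Prop :=
  ∀ (φ : ArithFormula) (E : ℕ → M.sets) (e : ℕ → M.Num),
    ∃ X ∈ M.sets, ∀ n : M.Num, n ∈ X ↔ M.Sat E φ (extend n e)

/-- `M` is a model of `RCA₀`. -/
structure ModelsRCA0 (M : L2Structure.{u}) : Prop where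
  basic : M.BasicAxioms
  induction : M.Sigma01Induction
  comprehension : M.Delta01Comprehension

/-- `M` is a model of `ACA₀`. -/
structure ModelsACA0 (M : L2Structure.{u}) : Prop where
  basic : M.BasicAxioms
  induction : M.InductionAxiom
  comprehension : M.ArithmeticalComprehension

/-! ## Finite strings, trees and partial functions inside a structure

The notions below are the usual formulas of second-order arithmetic, written out as they are
interpreted in `M`: all number quantifiers range over `M.Num`, all set quantifiers over `M.sets`.
-/

variable {M : L2Structure.{u}}

/-- The numerical pairing map `(i, j) = (i + j)² + i`. -/
def pair (i j : M.Num) : M.Num := (i + j) * (i + j) + i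

/-- `c` has the form `(k, (m, n))`. Such a number represents the finite set
`{i : i < k ∧ (m * (i + 1) + 1 divides n)}`. -/
def IsTriple (c : M.Num) : Prop := ∃ k m n : M.Num, c = pair k (pair m n)

/-- `i` belongs to the finite set represented by `c`. -/
def MemFin (i c : M.Num) : Prop :=
  ∃ k m n : M.Num, c = pair k (pair m n) ∧ i < k ∧ ∃ q : M.Num, n = (m * (i + 1) + 1) * q

/-- `c` is the code of a finite set, i.e. the least number representing that set. -/
def IsFinCode (c : M.Num) : Prop :=
  IsTriple c ∧ ∀ d : M.Num, d < c → IsTriple d → ¬ ∀ i : M.Num, MemFin i d ↔ MemFin i c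

/-- `σ(i) = a`, for (the code of) a finite string `σ`. -/
def Entry (σ i a : M.Num) : Prop := MemFin (pair i a) σ

/-- `σ` is (the code of) a finite string of length `l`, i.e. of a finite set of pairs that is the
graph of a function with domain `{i : i < l}`. -/
def IsStringOfLength (σ l : M.Num) : Prop :=
  IsFinCode σ ∧
  (∀ x : M.Num, MemFin x σ → ∃ i a : M.Num, x = pair i a ∧ i < l) ∧
  (∀ i : M.Num, i < l → ∃! a : M.Num, Entry σ i a)

/-- `σ` is (the code of) a finite string of natural numbers. -/
def IsString (σ : M.Num) : Prop := ∃ l : M.Num, IsStringOfLength σ l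

/-- The string `τ` is a prefix of the string `σ`. -/
def IsPrefix (τ σ : M.Num) : Prop := ∀ i a : M.Num, Entry τ i a → Entry σ i a

/-- The string `τ` is `σ` followed by the single further entry `a`. -/
def IsAppend (σ a τ : M.Num) : Prop :=
  ∃ l : M.Num, IsStringOfLength σ l ∧ IsStringOfLength τ (l + 1) ∧ IsPrefix σ τ ∧ Entry τ l a

/-- A class of numbers is infinite: it has elements above every number of the structure. -/
def IsInfinite (P : M.Num → Prop) : Prop := ∀ b : M.Num, ∃ x : M.Num, b < x ∧ P x

/-- `T` is a set of finite strings that is closed under prefixes. -/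
def IsTree (T : Set M.Num) : Prop :=
  (∀ σ ∈ T, IsString σ) ∧ ∀ σ ∈ T, ∀ τ : M.Num, IsString τ → IsPrefix τ σ → τ ∈ T

/-- Every string in `T` has only finitely many immediate successors in `T`. -/
def IsFinitelyBranching (T : Set M.Num) : Prop :=
  ∀ σ ∈ T, ∃ b : M.Num, ∀ a : M.Num, ∀ τ ∈ T, IsAppend σ a τ → a < b

/-- Every string in `T` has at most two immediate successors in `T`. -/
def IsTwoBranching (T : Set M.Num) : Prop :=
  ∀ σ ∈ T, ∀ τ₁ ∈ T, ∀ τ₂ ∈ T, ∀ τ₃ ∈ T,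
    (∃ a, IsAppend σ a τ₁) → (∃ a, IsAppend σ a τ₂) → (∃ a, IsAppend σ a τ₃) →
    τ₁ = τ₂ ∨ τ₁ = τ₃ ∨ τ₂ = τ₃

/-- `h` is (the graph of) a partial function with domain `D`. -/
def IsPartialFunction (h D : Set M.Num) : Prop :=
  (∀ x ∈ h, ∃ n a : M.Num, x = pair n a) ∧
  (∀ n a b : M.Num, pair n a ∈ h → pair n b ∈ h → a = b) ∧
  (∀ n : M.Num, n ∈ D ↔ ∃ a : M.Num, pair n a ∈ h)

/-- `h` is homogeneous for the string `σ`: `σ(n) = h(n)` for all `n ∈ dom h` with `n < |σ|`. -/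
def HomogeneousForString (h : Set M.Num) (σ : M.Num) : Prop :=
  ∀ n a l : M.Num, pair n a ∈ h → IsStringOfLength σ l → n < l → Entry σ n a

/-- `h` is homogeneous for the tree `T`: infinitely many strings in `T` agree with `h`. -/
def HomogeneousForTree (h T : Set M.Num) : Prop :=
  IsInfinite fun σ => σ ∈ T ∧ HomogeneousForString h σ

/-- In the structure there is an infinite partial function, whose domain exists as a set, that is
homogeneous for `T`. -/
def HasInfiniteHomogeneous (T : Set M.Num) : Prop :=
  ∃ h ∈ M.sets, ∃ D ∈ M.sets,
    IsPartialFunction h D ∧ IsInfinite (fun n => n ∈ D) ∧ HomogeneousForTree h T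

/-- `M` satisfies Ramsey-type König's lemma: every infinite, finitely branching tree has an infinite
homogeneous partial function. -/
def ModelsRKL (M : L2Structure.{u}) : Prop :=
  ∀ T ∈ M.sets, IsTree T → IsInfinite (fun σ => σ ∈ T) → IsFinitelyBranching T →
    HasInfiniteHomogeneous T

/-- `M` satisfies Ramsey-type König's lemma restricted to trees in which every string has at most
two immediate successors. -/
def ModelsRKLTwoBranching (M : L2Structure.{u}) : Prop :=
  ∀ T ∈ M.sets, IsTree T → IsInfinite (fun σ => σ ∈ T) → IsTwoBranching T →
    HasInfiniteHomogeneous T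

end L2Structure

/-! Both equivalences follow from one chain over RCA₀: ACA₀ ⟹ Σ⁰₁ comprehension ⟹ RKL ⟹ RKL₂ ⟹ Σ⁰₁
comprehension ⟹ ACA₀.

The reversal codes a modulus into a tree. For a bounded relation `R` and a length `l`, let s_l(i) be
the least number bounding a witness of `R x` for every x ≤ i that has a witness below `l`. Passing
from i - 1 to i, this value either stays the same or becomes one more than the least witness of `R
i`. In `modulusTree R` every entry must bound witnesses in this sense and be of one of these two
kinds, so each node has at most two successors, while the strings s_l make the tree infinite. If an
infinite homogeneous `h` has h(n) = a, then arbitrarily long strings of the tree have entry `a` at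
`n`, so `a` bounds a witness for every x ≤ n that has any witness. As dom(h) is unbounded, ∃ m, R x
m becomes Δ⁰₁ in `h` (`sigma_comprehension_of_homogeneous`). That unbounded codes force unbounded
lengths here is `modulusTree_bounded_of_length_le`, which needs strong Σ⁰₁ collection.

For the forward direction, the leftmost path through the extendible nodes is arithmetical, and it is
a homogeneous function with full domain (`SigmaComprehension.modelsRKL`).

Definability is handled semantically: `Bd` collects the relations given by bounded formulas with
parameters, and is translated into syntax once (`Bd.exists_formula`). Under Σ⁰₁ comprehension `Bd`
is closed under unbounded number quantifiers (`SigmaComprehension.bd_ex`), so every principle proved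
for `Bd` then holds for all arithmetical relations. The arithmetic of `M.Num` and the coding of
finite sets and strings are derived from Σ⁰₁ induction. -/

/-! ## Relations definable by bounded formulas with parameters -/

/-- Renaming of the number variables in a term. -/
def L2Term.ren (ρ : ℕ → ℕ) : L2Term → L2Term
  | .var i => .var (ρ i)
  | .zero => .zero
  | .one => .one
  | .add s t => .add (s.ren ρ) (t.ren ρ)
  | .mul s t => .mul (s.ren ρ) (t.ren ρ)

/-- The renaming `ρ`, pushed under a quantifier. -/
def liftRen (ρ : ℕ → ℕ) : ℕ → ℕ
  | 0 => 0
  | i + 1 => ρ i + 1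

/-- Renaming of the number variables (by `ρ`) and of the set variables (by `η`) in a formula. -/
def ArithFormula.ren (η : ℕ → ℕ) : (ℕ → ℕ) → ArithFormula → ArithFormula
  | ρ, .eq s t => .eq (s.ren ρ) (t.ren ρ)
  | ρ, .lt s t => .lt (s.ren ρ) (t.ren ρ)
  | ρ, .mem t i => .mem (t.ren ρ) (η i)
  | ρ, .not φ => .not (φ.ren η ρ)
  | ρ, .and φ ψ => .and (φ.ren η ρ) (ψ.ren η ρ)
  | ρ, .or φ ψ => .or (φ.ren η ρ) (ψ.ren η ρ)
  | ρ, .imp φ ψ => .imp (φ.ren η ρ) (ψ.ren η ρ)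
  | ρ, .ballLT t φ => .ballLT (t.ren ρ) (φ.ren η (liftRen ρ))
  | ρ, .bexLT t φ => .bexLT (t.ren ρ) (φ.ren η (liftRen ρ))
  | ρ, .all φ => .all (φ.ren η (liftRen ρ))
  | ρ, .ex φ => .ex (φ.ren η (liftRen ρ))

theorem ArithFormula.IsBounded.ren {φ : ArithFormula} (h : φ.IsBounded) (η ρ : ℕ → ℕ) :
    (φ.ren η ρ).IsBounded := by
  induction φ generalizing ρ with
  | eq | lt | mem => trivial
  | not φ ih => exact ih h ρ
  | and φ ψ ih₁ ih₂ => exact ⟨ih₁ h.1 ρ, ih₂ h.2 ρ⟩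
  | or φ ψ ih₁ ih₂ => exact ⟨ih₁ h.1 ρ, ih₂ h.2 ρ⟩
  | imp φ ψ ih₁ ih₂ => exact ⟨ih₁ h.1 ρ, ih₂ h.2 ρ⟩
  | ballLT t φ ih => exact ih h _
  | bexLT t φ ih => exact ih h _
  | all => exact h.elim
  | ex => exact h.elim

namespace L2Structure

section Definability

variable {M : L2Structure.{u}}

theorem eval_ren (t : L2Term) (ρ : ℕ → ℕ) (e : ℕ → M.Num) :
    M.eval e (t.ren ρ) = M.eval (e ∘ ρ) t := by
  induction t with
  | var => rfl
  | zero => rfl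
  | one => rfl
  | add s t ih₁ ih₂ => simp only [L2Term.ren, eval, ih₁, ih₂]
  | mul s t ih₁ ih₂ => simp only [L2Term.ren, eval, ih₁, ih₂]

theorem extend_comp_liftRen (a : M.Num) (e : ℕ → M.Num) (ρ : ℕ → ℕ) :
    extend a e ∘ liftRen ρ = extend a (e ∘ ρ) := by
  funext i; cases i <;> rfl

theorem sat_ren (φ : ArithFormula) (η ρ : ℕ → ℕ) (E : ℕ → M.sets) (e : ℕ → M.Num) :
    M.Sat E (φ.ren η ρ) e ↔ M.Sat (E ∘ η) φ (e ∘ ρ) := by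
  induction φ generalizing ρ e <;>
    simp_all only [ArithFormula.ren, Sat, eval_ren, extend_comp_liftRen, Function.comp_apply]

/-- The interleaving of two sequences. -/
def merge {α : Type*} (e p : ℕ → α) (i : ℕ) : α := if i % 2 = 0 then e (i / 2) else p (i / 2)

theorem merge_even {α : Type*} (e p : ℕ → α) (i : ℕ) : merge e p (2 * i) = e i := by
  simp [merge]

theorem merge_odd {α : Type*} (e p : ℕ → α) (i : ℕ) : merge e p (2 * i + 1) = p i := by
  have : (2 * i + 1) / 2 = i := by omega
  simp [merge, this]

theorem merge_ext {α : Type*} {f e p : ℕ → α} (h₀ : ∀ i, f (2 * i) = e i)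
    (h₁ : ∀ i, f (2 * i + 1) = p i) : f = merge e p := by
  funext i
  obtain ⟨j, rfl | rfl⟩ := i.even_or_odd'
  · rw [h₀, merge_even]
  · rw [h₁, merge_odd]

/-- Functions of an assignment given by terms with parameters. -/
inductive Tm (M : L2Structure.{u}) : ((ℕ → M.Num) → M.Num) → Prop
  | var (i : ℕ) : Tm M fun e => e i
  | const (a : M.Num) : Tm M fun _ => a
  | add {s t : (ℕ → M.Num) → M.Num} : Tm M s → Tm M t → Tm M fun e => s e + t e
  | mul {s t : (ℕ → M.Num) → M.Num} : Tm M s → Tm M t → Tm M fun e => s e * t e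

/-- Relations on an assignment given by bounded formulas with number and set parameters. -/
inductive Bd (M : L2Structure.{u}) : ((ℕ → M.Num) → Prop) → Prop
  | eq {s t : (ℕ → M.Num) → M.Num} : Tm M s → Tm M t → Bd M fun e => s e = t e
  | lt {s t : (ℕ → M.Num) → M.Num} : Tm M s → Tm M t → Bd M fun e => s e < t e
  | mem {t : (ℕ → M.Num) → M.Num} {A : Set M.Num} : Tm M t → A ∈ M.sets → Bd M fun e => t e ∈ A
  | not {P : (ℕ → M.Num) → Prop} : Bd M P → Bd M fun e => ¬ P e
  | and {P Q : (ℕ → M.Num) → Prop} : Bd M P → Bd M Q → Bd M fun e => P e ∧ Q e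
  | all_lt {t : (ℕ → M.Num) → M.Num} {P : (ℕ → M.Num) → Prop} : Tm M t → Bd M P →
      Bd M fun e => ∀ a, a < t e → P (extend a e)

theorem Tm.ren {t : (ℕ → M.Num) → M.Num} (ht : Tm M t) (ρ : ℕ → ℕ) :
    Tm M fun e => t fun i => e (ρ i) := by
  induction ht with
  | var i => exact .var _
  | const a => exact .const a
  | add _ _ ih₁ ih₂ => exact .add ih₁ ih₂
  | mul _ _ ih₁ ih₂ => exact .mul ih₁ ih₂

theorem Tm.subst {t : (ℕ → M.Num) → M.Num} (ht : Tm M t) {s : ℕ → (ℕ → M.Num) → M.Num}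
    (hs : ∀ i, Tm M (s i)) : Tm M fun e => t fun i => s i e := by
  induction ht with
  | var i => exact hs i
  | const a => exact .const a
  | add _ _ ih₁ ih₂ => exact .add ih₁ ih₂
  | mul _ _ ih₁ ih₂ => exact .mul ih₁ ih₂

theorem Tm.pair {s t : (ℕ → M.Num) → M.Num} (hs : Tm M s) (ht : Tm M t) :
    Tm M fun e => L2Structure.pair (s e) (t e) := ((hs.add ht).mul (hs.add ht)).add hs

theorem Bd.congr {P Q : (ℕ → M.Num) → Prop} (hP : Bd M P) (h : ∀ e, Q e ↔ P e) : Bd M Q := by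
  rwa [funext fun e => propext (h e)]

theorem Bd.subst {P : (ℕ → M.Num) → Prop} (hP : Bd M P) {s : ℕ → (ℕ → M.Num) → M.Num}
    (hs : ∀ i, Tm M (s i)) : Bd M fun e => P fun i => s i e := by
  induction hP generalizing s with
  | eq h₁ h₂ => exact .eq (h₁.subst hs) (h₂.subst hs)
  | lt h₁ h₂ => exact .lt (h₁.subst hs) (h₂.subst hs)
  | mem h hA => exact .mem (h.subst hs) hA
  | not _ ih => exact .not (ih hs)
  | and _ _ ih₁ ih₂ => exact .and (ih₁ hs) (ih₂ hs)
  | @all_lt t P ht _ ih =>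
    -- The substitution pushed under the binder: the bound variable stays fixed and the old terms
    -- read the shifted assignment.
    let s' : ℕ → (ℕ → M.Num) → M.Num := fun i => match i with
      | 0 => fun e => e 0
      | i + 1 => fun e => s i fun j => e (j + 1)
    have hs' : ∀ i, Tm M (s' i) := fun i => match i with
      | 0 => .var 0
      | i + 1 => (hs i).ren _
    refine (Bd.all_lt (ht.subst hs) (ih hs')).congr fun e => forall₂_congr fun a _ => ?_
    have : extend a (fun i => s i e) = fun i => s' i (extend a e) := by
      funext i; cases i <;> rfl
    rw [this]

/-- Separating the bound element from the outer assignment lets nested quantifiers be treated one at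
a time, the innermost bound variable always having index 0. -/
theorem Bd.ball {t : (ℕ → M.Num) → M.Num} {Q : (ℕ → M.Num) → M.Num → Prop} (ht : Tm M t)
    (hQ : Bd M fun e => Q (fun i => e (i + 1)) (e 0)) : Bd M fun e => ∀ a, a < t e → Q e a :=
  .all_lt ht hQ

theorem Bd.bex {t : (ℕ → M.Num) → M.Num} {Q : (ℕ → M.Num) → M.Num → Prop} (ht : Tm M t)
    (hQ : Bd M fun e => Q (fun i => e (i + 1)) (e 0)) : Bd M fun e => ∃ a, a < t e ∧ Q e a :=
  (Bd.ball (Q := fun e a => ¬ Q e a) ht hQ.not).not.congr fun e => by push Not; rfl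

theorem Bd.imp {P Q : (ℕ → M.Num) → Prop} (hP : Bd M P) (hQ : Bd M Q) :
    Bd M fun e => P e → Q e := (hP.and hQ.not).not.congr fun e => by tauto

theorem Bd.or {P Q : (ℕ → M.Num) → Prop} (hP : Bd M P) (hQ : Bd M Q) :
    Bd M fun e => P e ∨ Q e := (hP.not.and hQ.not).not.congr fun e => by tauto

theorem Bd.iff {P Q : (ℕ → M.Num) → Prop} (hP : Bd M P) (hQ : Bd M Q) :
    Bd M fun e => P e ↔ Q e := ((hP.imp hQ).and (hQ.imp hP)).congr fun e => by tauto

/-- The truth value of `p` is decided outside the structure, so `p` itself need not be definable. -/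
theorem Bd.const (M : L2Structure.{u}) (p : Prop) : Bd M fun _ => p := by
  by_cases h : p
  · exact (Bd.eq (.const 0) (.const 0)).congr fun e => by simp [h]
  · exact (Bd.eq (.const 0) (.const 0)).not.congr fun e => by simp [h]

theorem Bd.subst₁ {R : M.Num → Prop} (h : Bd M fun e => R (e 0)) {t : (ℕ → M.Num) → M.Num}
    (ht : Tm M t) : Bd M fun e => R (t e) := h.subst (s := fun _ => t) fun _ => ht

theorem Bd.subst₂ {R : M.Num → M.Num → Prop} (h : Bd M fun e => R (e 0) (e 1))
    {s t : (ℕ → M.Num) → M.Num} (hs : Tm M s) (ht : Tm M t) : Bd M fun e => R (s e) (t e) :=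
  h.subst (s := fun i => match i with | 0 => s | _ => t) fun i => match i with
    | 0 => hs
    | _ + 1 => ht

theorem Bd.subst₃ {R : M.Num → M.Num → M.Num → Prop} (h : Bd M fun e => R (e 0) (e 1) (e 2))
    {s t r : (ℕ → M.Num) → M.Num} (hs : Tm M s) (ht : Tm M t) (hr : Tm M r) :
    Bd M fun e => R (s e) (t e) (r e) :=
  h.subst (s := fun i => match i with | 0 => s | 1 => t | _ => r) fun i => match i with
    | 0 => hs
    | 1 => ht
    | _ + 2 => hr

/-! ### From semantic to syntactic definability -/

/-- Even positions hold variables and odd positions hold parameters. When two parameter lists are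
interleaved, `renLeft` and `renRight` redirect the parameters of a formula to the first or the
second list and fix the variables. -/
def renLeft (i : ℕ) : ℕ := if i % 2 = 0 then i else 2 * (2 * (i / 2)) + 1
def renRight (i : ℕ) : ℕ := if i % 2 = 0 then i else 2 * (2 * (i / 2) + 1) + 1

theorem merge_comp_renLeft {α : Type*} (e p q : ℕ → α) :
    merge e (merge p q) ∘ renLeft = merge e p := by
  refine merge_ext (fun i => ?_) fun i => ?_
  · have : renLeft (2 * i) = 2 * i := by simp [renLeft]
    rw [Function.comp_apply, this, merge_even]
  · have : renLeft (2 * i + 1) = 2 * (2 * i) + 1 := by unfold renLeft; split <;> omega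
    rw [Function.comp_apply, this, merge_odd, merge_even]

theorem merge_comp_renRight {α : Type*} (e p q : ℕ → α) :
    merge e (merge p q) ∘ renRight = merge e q := by
  refine merge_ext (fun i => ?_) fun i => ?_
  · have : renRight (2 * i) = 2 * i := by simp [renRight]
    rw [Function.comp_apply, this, merge_even]
  · have : renRight (2 * i + 1) = 2 * (2 * i + 1) + 1 := by unfold renRight; split <;> omega
    rw [Function.comp_apply, this, merge_odd, merge_odd]

theorem merge_comp_two_mul {α : Type*} (e p : ℕ → α) : (merge e p ∘ fun i => 2 * i) = e :=
  funext fun i => merge_even e p i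

theorem merge_comp_two_mul_add_one {α : Type*} (e p : ℕ → α) :
    (merge e p ∘ fun i => 2 * i + 1) = p := funext fun i => merge_odd e p i

theorem Tm.exists_term₂ {s t : (ℕ → M.Num) → M.Num}
    (hs : ∃ (s' : L2Term) (p : ℕ → M.Num), ∀ e, M.eval (merge e p) s' = s e)
    (ht : ∃ (t' : L2Term) (p : ℕ → M.Num), ∀ e, M.eval (merge e p) t' = t e) :
    ∃ (s' t' : L2Term) (p : ℕ → M.Num), ∀ e,
      M.eval (merge e p) s' = s e ∧ M.eval (merge e p) t' = t e := by
  obtain ⟨s', p, hs⟩ := hs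
  obtain ⟨t', q, ht⟩ := ht
  refine ⟨s'.ren renLeft, t'.ren renRight, merge p q, fun e => ?_⟩
  rw [eval_ren, eval_ren, merge_comp_renLeft, merge_comp_renRight]
  exact ⟨hs e, ht e⟩

theorem Tm.exists_term {t : (ℕ → M.Num) → M.Num} (ht : Tm M t) :
    ∃ (t' : L2Term) (p : ℕ → M.Num), ∀ e, M.eval (merge e p) t' = t e := by
  induction ht with
  | var i => exact ⟨.var (2 * i), fun _ => 0, fun e => merge_even e _ i⟩
  | const a => exact ⟨.var (2 * 0 + 1), fun _ => a, fun e => merge_odd e _ 0⟩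
  | add _ _ ih₁ ih₂ =>
    obtain ⟨s', t', p, h⟩ := Tm.exists_term₂ ih₁ ih₂
    exact ⟨.add s' t', p, fun e => by rw [eval, (h e).1, (h e).2]⟩
  | mul _ _ ih₁ ih₂ =>
    obtain ⟨s', t', p, h⟩ := Tm.exists_term₂ ih₁ ih₂
    exact ⟨.mul s' t', p, fun e => by rw [eval, (h e).1, (h e).2]⟩

/-- The renaming that exchanges the binding of a variable and the interleaving with parameters. -/
def renBind (i : ℕ) : ℕ := if i = 0 then 0 else if i % 2 = 0 then i - 1 else i + 1

theorem extend_merge_comp_renBind (a : M.Num) (e p : ℕ → M.Num) :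
    extend a (merge e p) ∘ renBind = merge (extend a e) p := by
  refine merge_ext (fun i => ?_) fun i => ?_
  · cases i with
    | zero => rfl
    | succ i =>
      have : renBind (2 * (i + 1)) = 2 * i + 1 := by unfold renBind; split_ifs <;> omega
      rw [Function.comp_apply, this]; exact merge_even e p i
  · have : renBind (2 * i + 1) = 2 * i + 1 + 1 := by unfold renBind; split_ifs <;> omega
    rw [Function.comp_apply, this]; exact merge_odd e p i

/-- The variables are interleaved with the parameters, so no finite bound on the variables that
occur has to be tracked when subformulas with different parameters are combined. -/
theorem Bd.exists_formula {P : (ℕ → M.Num) → Prop} (hP : Bd M P) :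
    ∃ (θ : ArithFormula) (E : ℕ → M.sets) (p : ℕ → M.Num), θ.IsBounded ∧
      ∀ e, M.Sat E θ (merge e p) ↔ P e := by
  have E₀ : ℕ → M.sets := fun _ => ⟨_, M.sets_nonempty.some_mem⟩
  induction hP with
  | eq h₁ h₂ =>
    obtain ⟨s', t', p, h⟩ := Tm.exists_term₂ h₁.exists_term h₂.exists_term
    exact ⟨.eq s' t', E₀, p, trivial, fun e => by rw [Sat, (h e).1, (h e).2]⟩
  | lt h₁ h₂ =>
    obtain ⟨s', t', p, h⟩ := Tm.exists_term₂ h₁.exists_term h₂.exists_term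
    exact ⟨.lt s' t', E₀, p, trivial, fun e => by rw [Sat, (h e).1, (h e).2]⟩
  | @mem t A ht hA =>
    obtain ⟨t', p, h⟩ := ht.exists_term
    exact ⟨.mem t' 0, fun _ => ⟨A, hA⟩, p, trivial, fun e => by rw [Sat, h e]⟩
  | not _ ih =>
    obtain ⟨θ, E, p, hθ, h⟩ := ih
    exact ⟨.not θ, E, p, hθ, fun e => by rw [Sat, h e]⟩
  | and _ _ ih₁ ih₂ =>
    obtain ⟨θ, E, p, hθ, h⟩ := ih₁
    obtain ⟨ψ, F, q, hψ, h'⟩ := ih₂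
    refine ⟨.and (θ.ren (fun i => 2 * i) renLeft) (ψ.ren (fun i => 2 * i + 1) renRight),
      merge E F, merge p q, ⟨hθ.ren _ _, hψ.ren _ _⟩, fun e => ?_⟩
    rw [Sat, sat_ren, sat_ren, merge_comp_renLeft, merge_comp_renRight, merge_comp_two_mul,
      merge_comp_two_mul_add_one, h, h']
  | all_lt ht _ ih =>
    obtain ⟨t', q, h⟩ := ht.exists_term
    obtain ⟨θ, E, p, hθ, h'⟩ := ih
    -- `renBind` moves the newly bound variable into the list of variables; `renRight`, lifted under
    -- the binder, then selects the parameters of the body.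
    refine ⟨.ballLT (t'.ren renLeft) (θ.ren id (liftRen renRight ∘ renBind)), E, merge q p,
      hθ.ren _ _, fun e => ?_⟩
    rw [Sat, eval_ren, merge_comp_renLeft, h]
    refine forall₂_congr fun a _ => ?_
    rw [sat_ren, ← Function.comp_assoc, extend_comp_liftRen, merge_comp_renRight,
      extend_merge_comp_renBind, Function.comp_id, h']

/-- The renaming that turns an interleaved assignment of two variables into a list. -/
def renTwo (i : ℕ) : ℕ := if i % 2 = 0 then (if i = 2 then 1 else 0) else i / 2 + 2

theorem extend_comp_renTwo (a n : M.Num) (p : ℕ → M.Num) :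
    extend a (extend n p) ∘ renTwo = merge (extend a (extend n fun _ => a)) p := by
  refine merge_ext (fun i => ?_) fun i => ?_
  · match i with
    | 0 => rfl
    | 1 => rfl
    | i + 2 =>
      have : renTwo (2 * (i + 2)) = 0 := by unfold renTwo; split_ifs <;> omega
      rw [Function.comp_apply, this]; rfl
  · have : renTwo (2 * i + 1) = i + 2 := by unfold renTwo; split_ifs <;> omega
    rw [Function.comp_apply, this]; rfl

/-! ### Induction and comprehension for relations in `Bd` -/

theorem Bd.exists_formula₂ {R : M.Num → M.Num → Prop} (h : Bd M fun e => R (e 0) (e 1)) :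
    ∃ (θ : ArithFormula) (E : ℕ → M.sets) (p : ℕ → M.Num), θ.IsBounded ∧
      ∀ n a, M.Sat E θ (extend a (extend n p)) ↔ R n a := by
  -- A quantifier over `a` will be put in front, so `a` takes index 0 and `n` index 1.
  obtain ⟨θ, E, p, hθ, h⟩ := (h.subst₂ (.var 1) (.var 0)).exists_formula
  refine ⟨θ.ren id renTwo, E, p, hθ.ren _ _, fun n a => ?_⟩
  rw [sat_ren, extend_comp_renTwo, Function.comp_id, h]
  rfl

theorem ModelsRCA0.sigma_induction (hM : M.ModelsRCA0) {R : M.Num → M.Num → Prop}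
    (hR : Bd M fun e => R (e 0) (e 1)) (h0 : ∃ a, R 0 a)
    (hs : ∀ n, (∃ a, R n a) → ∃ a, R (n + 1) a) (n : M.Num) : ∃ a, R n a := by
  obtain ⟨θ, E, p, hθ, h⟩ := hR.exists_formula₂
  have := hM.induction (.ex θ) ⟨θ, hθ, rfl⟩ E p
  simp only [Sat, h] at this
  exact this h0 hs n

theorem ModelsRCA0.bd_induction (hM : M.ModelsRCA0) {p : M.Num → Prop}
    (hp : Bd M fun e => p (e 0)) (h0 : p 0) (hs : ∀ n, p n → p (n + 1)) (n : M.Num) : p n := by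
  obtain ⟨_, h⟩ := hM.sigma_induction (R := fun n _ => p n) hp ⟨0, h0⟩
    (fun n ⟨a, h⟩ => ⟨a, hs n h⟩) n
  exact h

/-- `Δ⁰₁` comprehension, with the two definitions of the set given by relations. -/
theorem ModelsRCA0.delta_comprehension (hM : M.ModelsRCA0) {R S : M.Num → M.Num → Prop}
    (hR : Bd M fun e => R (e 0) (e 1)) (hS : Bd M fun e => S (e 0) (e 1))
    (h : ∀ n, (∃ a, R n a) ↔ ∀ a, S n a) : {n | ∃ a, R n a} ∈ M.sets := by
  obtain ⟨θ, E, p, hθ, hθ'⟩ := hR.exists_formula₂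
  obtain ⟨ψ, F, q, hψ, hψ'⟩ := hS.exists_formula₂
  -- The two definitions come with separate parameters; `ρ` keeps the two proper variables and
  -- relocates the parameters into the interleaved list.
  let ρ : (ℕ → ℕ) → ℕ → ℕ := fun f i => match i with
    | 0 => 0
    | 1 => 1
    | i + 2 => f i + 2
  have hρ : ∀ (f : ℕ → ℕ) (r : ℕ → M.Num) (a n : M.Num),
      extend a (extend n r) ∘ ρ f = extend a (extend n (r ∘ f)) := fun f r a n => by
    funext i
    match i with
    | 0 => rfl
    | 1 => rfl
    | i + 2 => rfl
  have := hM.comprehension (.ex (θ.ren (fun i => 2 * i) (ρ fun i => 2 * i)))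
    (.all (ψ.ren (fun i => 2 * i + 1) (ρ fun i => 2 * i + 1)))
    ⟨_, hθ.ren _ _, rfl⟩ ⟨_, hψ.ren _ _, rfl⟩ (merge E F) (merge p q)
  simp only [Sat, sat_ren, hρ, merge_comp_two_mul, merge_comp_two_mul_add_one, hθ', hψ'] at this
  obtain ⟨X, hX, hX'⟩ := this h
  rwa [show {n | ∃ a, R n a} = X from Set.ext fun n => (hX' n).symm]

theorem ModelsRCA0.bd_comprehension (hM : M.ModelsRCA0) {p : M.Num → Prop}
    (hp : Bd M fun e => p (e 0)) : {n | p n} ∈ M.sets := by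
  have := hM.delta_comprehension (R := fun n _ => p n) (S := fun n _ => p n) hp hp
    fun n => ⟨fun ⟨_, h⟩ _ => h, fun h => ⟨0, h 0⟩⟩
  rwa [show {n | ∃ _ : M.Num, p n} = {n | p n} from
    Set.ext fun n => ⟨fun ⟨_, h⟩ => h, fun h => ⟨0, h⟩⟩] at this

theorem ModelsACA0.sigma_comprehension (hM : M.ModelsACA0) {R : M.Num → M.Num → Prop}
    (hR : Bd M fun e => R (e 0) (e 1)) : {n | ∃ a, R n a} ∈ M.sets := by
  obtain ⟨θ, E, p, _, hθ⟩ := hR.exists_formula₂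
  obtain ⟨X, hX, hX'⟩ := hM.comprehension (.ex θ) E p
  simp only [Sat, hθ] at hX'
  rwa [show {n | ∃ a, R n a} = X from Set.ext fun n => (hX' n).symm]

end Definability

section Semiring

variable {M : L2Structure.{u}}

/-! ## The first-order part of a model of `RCA₀` is an ordered semiring -/

variable [hM : Fact M.ModelsRCA0]

theorem num_add_zero (a : M.Num) : a + 0 = a := hM.out.basic.add_zero a
theorem num_add_succ (a b : M.Num) : a + (b + 1) = (a + b) + 1 := hM.out.basic.add_succ a b
theorem num_mul_zero (a : M.Num) : a * 0 = 0 := hM.out.basic.mul_zero a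
theorem num_mul_succ (a b : M.Num) : a * (b + 1) = a * b + a := hM.out.basic.mul_succ a b
theorem num_lt_succ (a b : M.Num) : a < b + 1 ↔ a < b ∨ a = b := hM.out.basic.lt_succ a b
theorem num_not_lt_zero (a : M.Num) : ¬ a < 0 := hM.out.basic.not_lt_zero a

theorem bd_induction {p : M.Num → Prop} (hp : Bd M fun e => p (e 0)) (h0 : p 0)
    (hs : ∀ n, p n → p (n + 1)) (n : M.Num) : p n := hM.out.bd_induction hp h0 hs n

theorem sigma_induction {R : M.Num → M.Num → Prop}
    (hR : Bd M fun e => R (e 0) (e 1)) (h0 : ∃ a, R 0 a)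
    (hs : ∀ n, (∃ a, R n a) → ∃ a, R (n + 1) a) (n : M.Num) : ∃ a, R n a :=
  hM.out.sigma_induction hR h0 hs n

theorem num_zero_add (a : M.Num) : 0 + a = a :=
  bd_induction (p := fun a => 0 + a = a) (.eq (.add (.const _) (.var 0)) (.var 0)) (num_add_zero 0)
    (fun n h => by rw [num_add_succ, h]) a

theorem num_add_assoc (a b c : M.Num) : a + b + c = a + (b + c) :=
  bd_induction (p := fun c => a + b + c = a + (b + c))
    (.eq (.add (.const _) (.var 0)) (.add (.const _) (.add (.const _) (.var 0))))
    (by rw [num_add_zero, num_add_zero])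
    (fun n h => by rw [num_add_succ, num_add_succ, num_add_succ, h]) c

theorem num_one_add (a : M.Num) : 1 + a = a + 1 :=
  bd_induction (p := fun a => 1 + a = a + 1)
    (.eq (.add (.const _) (.var 0)) (.add (.var 0) (.const _)))
    (by rw [num_add_zero, num_zero_add])
    (fun n h => by rw [num_add_succ, h]) a

theorem num_add_comm (a b : M.Num) : a + b = b + a :=
  bd_induction (p := fun b => a + b = b + a)
    (.eq (.add (.const _) (.var 0)) (.add (.var 0) (.const _)))
    (by rw [num_add_zero, num_zero_add])
    (fun n h => by rw [num_add_succ, h, num_add_assoc n 1 a, num_one_add, num_add_succ]) b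

theorem num_left_distrib (a b c : M.Num) : a * (b + c) = a * b + a * c :=
  bd_induction (p := fun c => a * (b + c) = a * b + a * c)
    (.eq (.mul (.const _) (.add (.const _) (.var 0))) (.add (.const _) (.mul (.const _) (.var 0))))
    (by rw [num_add_zero, num_mul_zero, num_add_zero])
    (fun n h => by rw [num_add_succ, num_mul_succ, num_mul_succ, h, num_add_assoc]) c

theorem num_mul_assoc (a b c : M.Num) : a * b * c = a * (b * c) :=
  bd_induction (p := fun c => a * b * c = a * (b * c))
    (.eq (.mul (.const _) (.var 0)) (.mul (.const _) (.mul (.const _) (.var 0))))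
    (by simp only [num_mul_zero])
    (fun n h => by rw [num_mul_succ, num_mul_succ, num_left_distrib, h]) c

theorem num_right_distrib (a b c : M.Num) : (a + b) * c = a * c + b * c :=
  bd_induction (p := fun c => (a + b) * c = a * c + b * c)
    (.eq (.mul (.const _) (.var 0))
      (.add (.mul (.const _) (.var 0)) (.mul (.const _) (.var 0))))
    (by simp only [num_mul_zero, num_add_zero])
    (fun n h => by
      rw [num_mul_succ, num_mul_succ, num_mul_succ, h, num_add_assoc, num_add_assoc,
        ← num_add_assoc (b * n), num_add_comm (b * n) a, num_add_assoc]) c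

theorem num_zero_mul (a : M.Num) : 0 * a = 0 :=
  bd_induction (p := fun a => 0 * a = 0) (.eq (.mul (.const _) (.var 0)) (.const _)) (num_mul_zero 0)
    (fun n h => by rw [num_mul_succ, h, num_add_zero]) a

theorem num_mul_one (a : M.Num) : a * 1 = a := by
  rw [← num_zero_add (1 : M.Num), num_mul_succ, num_mul_zero, num_zero_add]

theorem num_one_mul (a : M.Num) : 1 * a = a :=
  bd_induction (p := fun a => 1 * a = a) (.eq (.mul (.const _) (.var 0)) (.var 0)) (num_mul_zero 1)
    (fun n h => by rw [num_mul_succ, h]) a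

theorem num_mul_comm (a b : M.Num) : a * b = b * a :=
  bd_induction (p := fun b => a * b = b * a)
    (.eq (.mul (.const _) (.var 0)) (.mul (.var 0) (.const _)))
    (by rw [num_mul_zero, num_zero_mul])
    (fun n h => by rw [num_mul_succ, h, num_right_distrib, num_one_mul]) b

theorem num_lt_trans {a b c : M.Num} (hab : a < b) (hbc : b < c) : a < c :=
  bd_induction (p := fun c => b < c → a < c)
    (.imp (.lt (.const _) (.var 0)) (.lt (.const _) (.var 0)))
    (fun h => (num_not_lt_zero _ h).elim)
    (fun n ih h => (num_lt_succ _ _).2 <| .inl <| by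
      rcases (num_lt_succ _ _).1 h with h | rfl
      exacts [ih h, hab]) c hbc

theorem num_lt_self_succ (a : M.Num) : a < a + 1 := (num_lt_succ _ _).2 (.inr rfl)

theorem num_succ_lt_succ {a b : M.Num} (h : a < b) : a + 1 < b + 1 :=
  bd_induction (p := fun b => a < b → a + 1 < b + 1)
    (.imp (.lt (.const _) (.var 0)) (.lt (.const _) (.add (.var 0) (.const _))))
    (fun h => (num_not_lt_zero _ h).elim)
    (fun n ih h => by
      rcases (num_lt_succ _ _).1 h with h | rfl
      exacts [num_lt_trans (ih h) (num_lt_self_succ _), num_lt_self_succ _]) b h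

theorem num_lt_irrefl (a : M.Num) : ¬ a < a :=
  bd_induction (p := fun a => ¬ a < a) (.not (.lt (.var 0) (.var 0))) (num_not_lt_zero _)
    (fun n ih h => by
      rcases (num_lt_succ _ _).1 h with h | h
      · exact ih (num_lt_trans (num_lt_self_succ _) h)
      · exact ih (by have := num_lt_self_succ n; rwa [h] at this)) a

theorem num_zero_lt_succ (a : M.Num) : 0 < a + 1 :=
  bd_induction (p := fun a => 0 < a + 1) (.lt (.const _) (.add (.var 0) (.const _))) 
    (num_lt_self_succ _) (fun _ ih => num_lt_trans ih (num_lt_self_succ _)) a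


theorem num_lt_trichotomy (a b : M.Num) : a < b ∨ a = b ∨ b < a :=
  bd_induction (p := fun b => a < b ∨ a = b ∨ b < a)
    (.or (.lt (.const _) (.var 0)) (.or (.eq (.const _) (.var 0)) (.lt (.var 0) (.const _))))
    (bd_induction (p := fun a => a < 0 ∨ a = 0 ∨ 0 < a)
      (.or (.lt (.var 0) (.const _)) (.or (.eq (.var 0) (.const _)) (.lt (.const _) (.var 0))))
      (.inr (.inl rfl)) (fun _ _ => .inr (.inr (num_zero_lt_succ _))) a)
    (fun n ih => by
      rcases ih with h | rfl | h
      · exact .inl (num_lt_trans h (num_lt_self_succ n))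
      · exact .inl (num_lt_self_succ a)
      · rcases (num_lt_succ _ _).1 (num_succ_lt_succ h) with h | h
        · exact .inr (.inr h)
        · exact .inr (.inl h.symm)) b

theorem num_add_lt_add_right {a b : M.Num} (h : a < b) (c : M.Num) : a + c < b + c :=
  bd_induction (p := fun c => a + c < b + c)
    (.lt (.add (.const _) (.var 0)) (.add (.const _) (.var 0)))
    (by simpa only [num_add_zero] using h)
    (fun n ih => by
      rw [num_add_succ, num_add_succ]
      exact num_succ_lt_succ ih) c

/-- Subtraction by Σ⁰₁ induction on `b`. The disjunct `b < a` lets the induction start at 0, and a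
separate induction shows that a positive difference is a successor. -/
theorem num_exists_add_of_lt {a b : M.Num} (h : a < b) : ∃ c, a + (c + 1) = b := by
  obtain ⟨c, hc⟩ := sigma_induction (R := fun b c => b < a ∨ b = a + c)
    (.or (.lt (.var 0) (.const _)) (.eq (.var 0) (.add (.const _) (.var 1))))
    (by
      rcases num_lt_trichotomy 0 a with h | h | h
      · exact ⟨0, .inl h⟩
      · exact ⟨0, .inr (by rw [num_add_zero, h])⟩
      · exact (num_not_lt_zero _ h).elim)
    (fun n ⟨c, h⟩ => by
      rcases h with h | rfl
      · rcases (num_lt_succ _ _).1 (num_succ_lt_succ h) with h | h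
        · exact ⟨0, .inl h⟩
        · exact ⟨0, .inr (by rw [num_add_zero, h])⟩
      · exact ⟨c + 1, .inr (num_add_succ _ _).symm⟩) b
  rcases hc with hc | rfl
  · exact (num_lt_irrefl _ (num_lt_trans h hc)).elim
  rcases num_lt_trichotomy 0 c with hc | rfl | hc
  · obtain ⟨d, rfl⟩ : ∃ d, c = d + 1 := by
      have : ∃ d, c = 0 ∨ c = d + 1 := sigma_induction (R := fun c d => c = 0 ∨ c = d + 1)
        (.or (.eq (.var 0) (.const _)) (.eq (.var 0) (.add (.var 1) (.const _))))
        ⟨0, .inl rfl⟩ (fun n _ => ⟨n, .inr rfl⟩) c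
      obtain ⟨d, rfl | rfl⟩ := this
      exacts [(num_not_lt_zero _ hc).elim, ⟨d, rfl⟩]
    exact ⟨d, rfl⟩
  · rw [num_add_zero] at h
    exact (num_lt_irrefl _ h).elim
  · exact (num_not_lt_zero _ hc).elim

instance : CommSemiring M.Num where
  add_assoc := num_add_assoc
  zero_add := num_zero_add
  add_zero := num_add_zero
  add_comm := num_add_comm
  left_distrib := num_left_distrib
  right_distrib := num_right_distrib
  zero_mul := num_zero_mul
  mul_zero := num_mul_zero
  mul_assoc := num_mul_assoc
  one_mul := num_one_mul
  mul_one := num_mul_one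
  mul_comm := num_mul_comm
  nsmul := nsmulRec

noncomputable instance : LinearOrder M.Num where
  le a b := a < b ∨ a = b
  le_refl a := .inr rfl
  le_trans a b c := by
    rintro (h | rfl) (h' | rfl)
    exacts [.inl (num_lt_trans h h'), .inl h, .inl h', .inr rfl]
  lt_iff_le_not_ge a b := by
    refine ⟨fun h => ⟨.inl h, ?_⟩, fun ⟨h, h'⟩ => ?_⟩
    · rintro (h' | rfl)
      exacts [num_lt_irrefl _ (num_lt_trans h h'), num_lt_irrefl _ h]
    · rcases h with h | rfl
      exacts [h, (h' (.inr rfl)).elim]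
  le_antisymm a b := by
    rintro (h | rfl) (h' | h')
    exacts [(num_lt_irrefl _ (num_lt_trans h h')).elim, h'.symm, rfl, rfl]
  le_total a b := by
    rcases num_lt_trichotomy a b with h | h | h
    exacts [.inl (.inl h), .inl (.inr h), .inr (.inl h)]
  toDecidableLE := Classical.decRel _

theorem num_le_iff (a b : M.Num) : a ≤ b ↔ a < b ∨ a = b := Iff.rfl

theorem lt_add_one_iff_le {a b : M.Num} : a < b + 1 ↔ a ≤ b := num_lt_succ a b

theorem num_zero_le (a : M.Num) : 0 ≤ a := not_lt.1 (num_not_lt_zero a)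

instance : IsOrderedCancelAddMonoid M.Num where
  add_le_add_left a b h c := by
    rcases h with h | rfl
    exacts [.inl (num_add_lt_add_right h c), le_rfl]
  le_of_add_le_add_left a b c h := by
    by_contra h'
    have := num_add_lt_add_right (not_le.1 h') a
    rw [num_add_comm c, num_add_comm b] at this
    exact absurd this (not_lt.2 h)

instance : CanonicallyOrderedAdd M.Num where
  exists_add_of_le {a b} h := by
    rcases h with h | rfl
    · obtain ⟨c, rfl⟩ := num_exists_add_of_lt h
      exact ⟨_, rfl⟩
    · exact ⟨0, (num_add_zero _).symm⟩
  le_self_add a b := by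
    rcases num_zero_le b with h | rfl
    · have := num_add_lt_add_right h a
      rw [num_zero_add, num_add_comm] at this
      exact .inl this
    · exact .inr (num_add_zero _).symm
  le_add_self a b := by
    rcases num_zero_le b with h | rfl
    · have := num_add_lt_add_right h a
      rw [num_zero_add] at this
      exact .inl this
    · exact .inr (num_zero_add _).symm

instance : Nontrivial M.Num := ⟨0, 1, fun h => num_lt_irrefl (0 : M.Num) <| by
  conv_rhs => rw [h, ← num_zero_add 1]
  exact num_lt_self_succ 0⟩

theorem num_mul_lt_mul_of_pos_left {a b c : M.Num} (hc : 0 < c) (hab : a < b) :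
    c * a < c * b := by
  obtain ⟨d, rfl⟩ := num_exists_add_of_lt hab
  rw [mul_add, mul_add, mul_one]
  exact lt_add_of_pos_right _ (lt_of_lt_of_le hc le_add_self)

instance : IsStrictOrderedRing M.Num where
  zero_le_one := num_zero_le 1
  mul_lt_mul_of_pos_left _ hc _ _ h := num_mul_lt_mul_of_pos_left hc h
  mul_lt_mul_of_pos_right c hc a b h := by
    rw [mul_comm a, mul_comm b]
    exact num_mul_lt_mul_of_pos_left hc h

theorem num_cases (a : M.Num) : a = 0 ∨ ∃ b, a = b + 1 := by
  rcases num_zero_le a with h | rfl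
  · obtain ⟨b, hb⟩ := num_exists_add_of_lt h
    exact .inr ⟨b, by rw [← hb, zero_add]⟩
  · exact .inl rfl

theorem num_lt_iff_add_one_le {a b : M.Num} : a < b ↔ a + 1 ≤ b := by
  rw [← lt_add_one_iff_le, add_lt_add_iff_right]

/-! ### Bounded quantification and least elements -/

theorem Bd.le {s t : (ℕ → M.Num) → M.Num} (hs : Tm M s) (ht : Tm M t) :
    Bd M fun e => s e ≤ t e := (Bd.lt hs ht).or (Bd.eq hs ht)

theorem bd_strong_induction {p : M.Num → Prop} (hp : Bd M fun e => p (e 0))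
    (h : ∀ n, (∀ k < n, p k) → p n) (n : M.Num) : p n := by
  refine h n (bd_induction (p := fun n => ∀ k < n, p k) (.ball (.var 0) (hp.subst₁ (.var 0)))
    (fun k hk => (num_not_lt_zero k hk).elim) (fun n ih k hk => ?_) n)
  rcases (num_lt_succ _ _).1 hk with hk | rfl
  exacts [ih k hk, h _ ih]

theorem bd_exists_least {p : M.Num → Prop} (hp : Bd M fun e => p (e 0)) {n : M.Num} (hn : p n) :
    ∃ n, p n ∧ ∀ k < n, ¬ p k := by
  by_contra! h
  exact bd_strong_induction (p := fun n => ¬ p n) hp.not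
    (fun n ih hn => (h n hn).elim fun k hk => ih k hk.1 hk.2) n hn

end Semiring

/-! ### Coding of finite sets in the manner of Gödel's β function -/

section FiniteSets

variable {M : L2Structure.{u}} [hM : Fact M.ModelsRCA0]

theorem Bd.ball_le {t : (ℕ → M.Num) → M.Num} {Q : (ℕ → M.Num) → M.Num → Prop} (ht : Tm M t)
    (hQ : Bd M fun e => Q (fun i => e (i + 1)) (e 0)) : Bd M fun e => ∀ a, a ≤ t e → Q e a :=
  (Bd.ball (ht.add (.const 1)) hQ).congr fun e => by simp only [lt_add_one_iff_le]

theorem Bd.bex_le {t : (ℕ → M.Num) → M.Num} {Q : (ℕ → M.Num) → M.Num → Prop} (ht : Tm M t)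
    (hQ : Bd M fun e => Q (fun i => e (i + 1)) (e 0)) : Bd M fun e => ∃ a, a ≤ t e ∧ Q e a :=
  (Bd.bex (ht.add (.const 1)) hQ).congr fun e => by simp only [lt_add_one_iff_le]

theorem num_zero_lt_one : (0 : M.Num) < 1 := zero_lt_one

theorem num_le_mul_self (a : M.Num) : a ≤ a * a := by
  obtain rfl | ⟨b, rfl⟩ := num_cases a
  · exact num_zero_le _
  · rw [mul_add, mul_one]; exact le_add_self

theorem Bd.dvd {s t : (ℕ → M.Num) → M.Num} (hs : Tm M s) (ht : Tm M t) :
    Bd M fun e => s e ∣ t e := by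
  refine Bd.subst₂ (R := fun s t => s ∣ t) ?_ hs ht
  refine (Bd.bex_le (.var 1) (Q := fun e q => e 1 = e 0 * q)
    (.eq (.var 2) (.mul (.var 1) (.var 0)))).congr fun e => ⟨fun ⟨q, hq⟩ => ?_,
      fun ⟨q, _, hq⟩ => ⟨q, hq⟩⟩
  obtain h | ⟨b, h⟩ := num_cases (e 0)
  -- With divisor 0 any quotient works and may exceed the bound, so it is replaced by 0; a positive
  -- divisor bounds the quotient by the dividend.
  · exact ⟨0, num_zero_le _, by rw [hq, h, zero_mul, zero_mul]⟩
  · refine ⟨q, ?_, hq⟩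
    rw [hq, h, add_mul, one_mul]
    exact le_add_self

/-! ## Pairing -/

theorem add_le_pair (i j : M.Num) : i + j ≤ pair i j :=
  (num_le_mul_self _).trans le_self_add

theorem left_le_pair (i j : M.Num) : i ≤ pair i j := le_self_add.trans (add_le_pair i j)

theorem right_le_pair (i j : M.Num) : j ≤ pair i j := le_add_self.trans (add_le_pair i j)

/-- With s = i + j, the pair lies between s² and s² + s < (s + 1)², so pairs with a larger sum come
later. -/
theorem pair_lt_pair_of_add_lt {i j i' j' : M.Num} (h : i + j < i' + j') :
    pair i j < pair i' j' := by
  obtain ⟨d, hd⟩ := num_exists_add_of_lt h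
  have : pair i' j' = pair i j + (j + (i + j) + 1 + (d * (i + j + (i + j) + d + 1 + 1) + i')) := by
    unfold pair; rw [← hd]; ring
  rw [this]
  refine lt_add_of_pos_right _ (lt_of_lt_of_le (num_zero_lt_succ (j + (i + j))) ?_)
  exact le_self_add

theorem pair_inj {i j i' j' : M.Num} : pair i j = pair i' j' ↔ i = i' ∧ j = j' := by
  refine ⟨fun h => ?_, fun ⟨h, h'⟩ => by rw [h, h']⟩
  have hs : i + j = i' + j' := by
    rcases lt_trichotomy (i + j) (i' + j') with h' | h' | h'
    · exact absurd h (pair_lt_pair_of_add_lt h').ne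
    · exact h'
    · exact absurd h (pair_lt_pair_of_add_lt h').ne'
  have hi : i = i' := by
    unfold pair at h
    rw [hs] at h
    exact add_left_cancel h
  exact ⟨hi, by rw [hi] at hs; exact add_left_cancel hs⟩

theorem pair_le_pair {i j i' j' : M.Num} (hi : i ≤ i') (hj : j ≤ j') :
    pair i j ≤ pair i' j' := by
  unfold pair; gcongr

/-! ## Collection -/

/-- The hypothesis "every k < n has a witness" is not literally Σ⁰₁. One common bound for all the
witnesses makes it so, and ordinary Σ⁰₁ induction applies. -/
theorem sigma_strong_induction {R : M.Num → M.Num → Prop} (hR : Bd M fun e => R (e 0) (e 1))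
    (h : ∀ n, (∀ k < n, ∃ a, R k a) → ∃ a, R n a) (n : M.Num) : ∃ a, R n a := by
  have : ∀ n, ∃ b, ∀ k, k < n → ∃ a, a < b ∧ R k a := by
    refine sigma_induction (.ball (.var 0) (.bex (.var 2) (hR.subst₂ (.var 1) (.var 0))))
      ⟨0, fun k hk => (num_not_lt_zero k hk).elim⟩ fun n ⟨b, hb⟩ => ?_
    obtain ⟨a, ha⟩ := h n fun k hk => let ⟨a, _, ha⟩ := hb k hk; ⟨a, ha⟩
    refine ⟨max b (a + 1), fun k hk => ?_⟩
    rcases (num_lt_succ _ _).1 hk with hk | rfl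
    · obtain ⟨a', h₁, h₂⟩ := hb k hk
      exact ⟨a', lt_max_of_lt_left h₁, h₂⟩
    · exact ⟨a, lt_max_of_lt_right (num_lt_self_succ a), ha⟩
  obtain ⟨b, hb⟩ := this (n + 1)
  obtain ⟨a, _, ha⟩ := hb n (num_lt_self_succ n)
  exact ⟨a, ha⟩

/-- The least element principle for `Π⁰₁` relations. -/
theorem pi_exists_least {S : M.Num → M.Num → Prop} (hS : Bd M fun e => S (e 0) (e 1))
    {n : M.Num} (hn : ∀ a, S n a) : ∃ n, (∀ a, S n a) ∧ ∀ k < n, ¬ ∀ a, S k a := by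
  by_contra! h
  have := sigma_strong_induction (R := fun n a => ¬ S n a) hS.not (fun n ih => by
    by_contra! hn
    obtain ⟨k, hk, hk'⟩ := h n hn
    obtain ⟨a, ha⟩ := ih k hk
    exact ha (hk' a)) n
  obtain ⟨a, ha⟩ := this
  exact ha (hn a)

/-- `Σ⁰₁` collection. -/
theorem bd_collection {R : M.Num → M.Num → Prop} (hR : Bd M fun e => R (e 0) (e 1)) (n : M.Num)
    (h : ∀ k < n, ∃ a, R k a) : ∃ b, ∀ k < n, ∃ a < b, R k a := by
  -- The induction variable `m` runs past `n`; the premise `k < n` makes those steps vacuous.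
  have : ∀ m, ∃ b, ∀ k, k < m → k < n → ∃ a, a < b ∧ R k a := by
    refine sigma_induction (.ball (.var 0) (.imp (.lt (.var 0) (.const n)) (.bex (.var 2)
      (hR.subst₂ (.var 1) (.var 0))))) ⟨0, fun k hk => (num_not_lt_zero k hk).elim⟩
      fun m ⟨b, hb⟩ => ?_
    by_cases hm : m < n
    · obtain ⟨a, ha⟩ := h m hm
      refine ⟨max b (a + 1), fun k hk hkn => ?_⟩
      rcases (num_lt_succ _ _).1 hk with hk | rfl
      · obtain ⟨a', h₁, h₂⟩ := hb k hk hkn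
        exact ⟨a', lt_max_of_lt_left h₁, h₂⟩
      · exact ⟨a, lt_max_of_lt_right (num_lt_self_succ a), ha⟩
    · refine ⟨b, fun k hk hkn => ?_⟩
      rcases (num_lt_succ _ _).1 hk with hk | rfl
      · exact hb k hk hkn
      · exact absurd hkn hm
  obtain ⟨b, hb⟩ := this n
  exact ⟨b, fun k hk => hb k hk hk⟩

/-! ## Divisibility and codes of finite sets -/

/-- There is no subtraction, so the two quotients are compared; if that of `b` is at least that of
the sum, then `a` is 0. -/
theorem dvd_of_dvd_add {p a b : M.Num} (h : p ∣ a + b) (hb : p ∣ b) : p ∣ a := by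
  obtain ⟨u, hu⟩ := h
  obtain ⟨v, rfl⟩ := hb
  rcases le_total v u with huv | huv
  · obtain ⟨w, rfl⟩ := exists_add_of_le huv
    exact ⟨w, by rw [mul_add, add_comm] at hu; exact add_left_cancel hu⟩
  · have h₁ : p * u ≤ p * v := by gcongr
    rw [← hu] at h₁
    have h₂ : a = 0 := by
      have : a + p * v ≤ 0 + p * v := by rwa [zero_add]
      exact le_antisymm (le_of_add_le_add_right this) (num_zero_le a)
    rw [h₂]; exact dvd_zero p

/-- Coprimality of the β-function moduli, by an explicit Bézout identity. Write p = m(i + 1) + 1 and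
q = m(j + 1) + 1. Since |i - j| divides `m`, say m = |i - j|·e, and m(i + 1) ≡ -1 modulo p, the
product q·e·(i + 1)² is congruent to 1 or to -1 modulo p, according to the order of i and j. -/
theorem modulus_dvd_of_dvd_mul {m n i j : M.Num} (hij : i ≠ j)
    (hm : ∀ d, 0 < d → d ≤ max i j → d ∣ m)
    (h : m * (i + 1) + 1 ∣ (m * (j + 1) + 1) * n) : m * (i + 1) + 1 ∣ n := by
  rcases lt_or_gt_of_ne hij with hij | hij
  · obtain ⟨c, rfl⟩ := num_exists_add_of_lt hij
    obtain ⟨e, rfl⟩ := hm (c + 1) (num_zero_lt_succ c)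
      (le_max_of_le_right le_add_self)
    refine dvd_of_dvd_add (b := ((c + 1) * e * (i + 1) + 1) * (e * (i + 1) * (i + (c + 1) + 1) * n))
      ?_ (dvd_mul_right _ _)
    have : n + ((c + 1) * e * (i + 1) + 1) * (e * (i + 1) * (i + (c + 1) + 1) * n) =
      ((c + 1) * e * (i + 1) + 1) * n +
        ((c + 1) * e * (i + (c + 1) + 1) + 1) * n * (e * (i + 1) * (i + 1)) := by ring
    rw [this]
    exact dvd_add (dvd_mul_right _ _) (h.mul_right _)
  · obtain ⟨c, rfl⟩ := num_exists_add_of_lt hij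
    obtain ⟨e, rfl⟩ := hm (c + 1) (num_zero_lt_succ c)
      (le_max_of_le_left le_add_self)
    refine dvd_of_dvd_add (b := ((c + 1) * e * (j + 1) + 1) * n *
        (e * (j + (c + 1) + 1) * (j + (c + 1) + 1))) ?_ (h.mul_right _)
    have : n + ((c + 1) * e * (j + 1) + 1) * n * (e * (j + (c + 1) + 1) * (j + (c + 1) + 1)) =
      ((c + 1) * e * (j + (c + 1) + 1) + 1) *
        (n + n * e * (j + (c + 1) + 1) * (j + 1)) := by ring
    rw [this]
    exact dvd_mul_right _ _

/-- A substitute for k!, obtained by Σ⁰₁ induction because products of sequences are not yet coded.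
-/
theorem exists_common_multiple (k : M.Num) : ∃ m, 0 < m ∧ ∀ d, d ≤ k → 0 < d → d ∣ m := by
  refine sigma_induction (R := fun k m => 0 < m ∧ ∀ d, d ≤ k → 0 < d → d ∣ m)
    (.and (.lt (.const 0) (.var 1)) (.ball_le (.var 0) (.imp (.lt (.const 0) (.var 0))
      (.dvd (.var 0) (.var 2))))) ⟨1, num_zero_lt_one, fun d hd h => absurd hd (not_le.2 h)⟩
    (fun k ⟨m, hm, h⟩ => ⟨m * (k + 1), mul_pos hm (num_zero_lt_succ k), fun d hd hd' => ?_⟩) k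
  rcases hd with hd | rfl
  · exact (h d (lt_add_one_iff_le.1 hd) hd').mul_right _
  · exact dvd_mul_left _ _

theorem exists_modulus_multiple (m k : M.Num) :
    ∃ n, 0 < n ∧ ∀ i, i < k → m * (i + 1) + 1 ∣ n := by
  refine sigma_induction (R := fun k n => 0 < n ∧ ∀ i, i < k → m * (i + 1) + 1 ∣ n)
    (.and (.lt (.const 0) (.var 1)) (.ball (.var 0)
      (.dvd (.add (.mul (.const m) (.add (.var 0) (.const 1))) (.const 1)) (.var 2))))
    ⟨1, num_zero_lt_one, fun i hi => (num_not_lt_zero i hi).elim⟩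
    (fun k ⟨n, hn, h⟩ => ⟨n * (m * (k + 1) + 1), mul_pos hn (num_zero_lt_succ _),
      fun i hi => ?_⟩) k
  rcases (num_lt_succ _ _).1 hi with hi | rfl
  · exact (h i hi).mul_right _
  · exact dvd_mul_left _ _

theorem memFin_pair {i k m n : M.Num} :
    MemFin i (pair k (pair m n)) ↔ i < k ∧ m * (i + 1) + 1 ∣ n := by
  constructor
  · rintro ⟨k', m', n', h, hi, hq⟩
    rw [pair_inj, pair_inj] at h
    obtain ⟨rfl, rfl, rfl⟩ := h
    exact ⟨hi, hq⟩
  · rintro ⟨hi, hq⟩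
    exact ⟨k, m, n, rfl, hi, hq⟩

/-- Bounded `Σ⁰₁` comprehension, for codes of finite sets, with a bound on the codes. -/
theorem exists_triple_bound (k : M.Num) : ∃ C, ∀ R : M.Num → M.Num → Prop,
    (Bd M fun e => R (e 0) (e 1)) →
      ∃ c ≤ C, IsTriple c ∧ ∀ i, MemFin i c ↔ i < k ∧ ∃ a, R i a := by
  obtain ⟨m, hm0, hm⟩ := exists_common_multiple k
  -- `N` is a multiple of all the moduli, so it is a candidate for every `R`; this gives a bound on
  -- the codes that does not depend on `R`.
  obtain ⟨N, hN0, hN⟩ := exists_modulus_multiple m k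
  refine ⟨pair k (pair m N), fun R hR => ?_⟩
  have hS : Bd M fun e => 0 < e 0 ∧ ∀ i, i < k → R i (e 1) → m * (i + 1) + 1 ∣ e 0 :=
    .and (.lt (.const 0) (.var 0)) (.ball (.const k) (.imp (hR.subst₂ (.var 0) (.var 2))
      (.dvd (.add (.mul (.const m) (.add (.var 0) (.const 1))) (.const 1)) (.var 1))))
  have hNS : ∀ a, 0 < N ∧ ∀ i, i < k → R i a → m * (i + 1) + 1 ∣ N :=
    fun a => ⟨hN0, fun i hi _ => hN i hi⟩
  -- The least positive number divisible by the moduli of all members plays the role of their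
  -- product. The condition is Π⁰₁, so a least one exists.
  obtain ⟨n, hn, hmin⟩ := pi_exists_least
    (S := fun n a => 0 < n ∧ ∀ i, i < k → R i a → m * (i + 1) + 1 ∣ n) hS hNS
  have hn0 := (hn 0).1
  refine ⟨pair k (pair m n), pair_le_pair le_rfl (pair_le_pair le_rfl
    (not_lt.1 fun h => hmin N h hNS)), ⟨k, m, n, rfl⟩, fun i => ?_⟩
  rw [memFin_pair]
  refine and_congr_right fun hi => ⟨fun hdvd => ?_, fun ⟨a, ha⟩ => (hn a).2 i hi ha⟩
  by_contra! hi'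
  -- If the modulus of a nonmember divided it, the quotient would be smaller and, by coprimality,
  -- still divisible by the moduli of all members.
  obtain ⟨n', rfl⟩ := hdvd
  have hn'0 : 0 < n' := pos_of_mul_pos_right hn0 (num_zero_le _)
  refine hmin n' ?_ fun a => ⟨hn'0, fun j hj hja => ?_⟩
  · rw [add_mul, one_mul]
    exact lt_add_of_pos_left _ (mul_pos (mul_pos hm0 (num_zero_lt_succ i)) hn'0)
  · have hji : j ≠ i := by rintro rfl; exact hi' a hja
    exact modulus_dvd_of_dvd_mul hji
      (fun d hd hd' => hm d (hd'.trans (max_le hj.le hi.le)) hd) ((hn a).2 j hj hja)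

theorem lt_of_memFin {i c : M.Num} (h : MemFin i c) : i < c := by
  obtain ⟨k, m, n, rfl, hi, _⟩ := h
  exact hi.trans_le (left_le_pair _ _)

theorem Bd.memFin {s t : (ℕ → M.Num) → M.Num} (hs : Tm M s) (ht : Tm M t) :
    Bd M fun e => MemFin (s e) (t e) := by
  refine Bd.subst₂ (R := fun i c => MemFin i c) ?_ hs ht
  refine (Bd.bex_le (.var 1) (Q := fun e k => ∃ m, m ≤ e 1 ∧ ∃ n, n ≤ e 1 ∧
    (e 1 = L2Structure.pair k (L2Structure.pair m n) ∧ e 0 < k ∧ m * (e 0 + 1) + 1 ∣ n))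
    (.bex_le (.var 2) (.bex_le (.var 3) (.and (.eq (.var 4) (.pair (.var 2)
      (.pair (.var 1) (.var 0)))) (.and (.lt (.var 3) (.var 2)) (.dvd (.add (.mul (.var 1)
        (.add (.var 3) (.const 1))) (.const 1)) (.var 0))))))).congr fun e => ?_
  constructor
  · rintro ⟨k, m, n, h, h'⟩
    rw [h]
    exact ⟨k, left_le_pair _ _, m, (left_le_pair _ _).trans (right_le_pair _ _), n,
      (right_le_pair _ _).trans (right_le_pair _ _), rfl, h'⟩
  · rintro ⟨k, _, m, _, n, _, h⟩
    exact ⟨k, m, n, h⟩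

theorem Bd.isTriple {s : (ℕ → M.Num) → M.Num} (hs : Tm M s) :
    Bd M fun e => IsTriple (s e) := by
  refine Bd.subst₁ (R := IsTriple) ?_ hs
  refine (Bd.bex_le (.var 0) (Q := fun e k => ∃ m, m ≤ e 0 ∧ ∃ n, n ≤ e 0 ∧
    e 0 = L2Structure.pair k (L2Structure.pair m n))
    (.bex_le (.var 1) (.bex_le (.var 2) (.eq (.var 3) (.pair (.var 2)
      (.pair (.var 1) (.var 0))))))).congr fun e => ?_
  constructor
  · rintro ⟨k, m, n, h⟩
    rw [h]
    exact ⟨k, left_le_pair _ _, m, (left_le_pair _ _).trans (right_le_pair _ _), n,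
      (right_le_pair _ _).trans (right_le_pair _ _), rfl⟩
  · rintro ⟨k, _, m, _, n, _, h⟩
    exact ⟨k, m, n, h⟩

theorem Bd.sameMembers {s t : (ℕ → M.Num) → M.Num} (hs : Tm M s) (ht : Tm M t) :
    Bd M fun e => ∀ i, MemFin i (s e) ↔ MemFin i (t e) := by
  refine Bd.subst₂ (R := fun c d => ∀ i, MemFin i c ↔ MemFin i d) ?_ hs ht
  refine (Bd.ball (.add (.var 0) (.var 1)) (Q := fun e i => MemFin i (e 0) ↔ MemFin i (e 1))
    (.iff (.memFin (.var 0) (.var 1)) (.memFin (.var 0) (.var 2)))).congr fun e => ?_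
  refine ⟨fun h i _ => h i, fun h i => ⟨fun hi => ?_, fun hi => ?_⟩⟩
  · exact (h i ((lt_of_memFin hi).trans_le le_self_add)).1 hi
  · exact (h i ((lt_of_memFin hi).trans_le le_add_self)).2 hi

theorem Bd.isFinCode {s : (ℕ → M.Num) → M.Num} (hs : Tm M s) :
    Bd M fun e => IsFinCode (s e) :=
  Bd.subst₁ (R := IsFinCode) (.and (.isTriple (.var 0)) (.ball (.var 0) (.imp (.isTriple (.var 0))
    (.not (.sameMembers (.var 0) (.var 1)))))) hs

theorem IsFinCode.eq_of_memFin_iff {c d : M.Num} (hc : IsFinCode c) (hd : IsFinCode d)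
    (h : ∀ i, MemFin i c ↔ MemFin i d) : c = d := by
  rcases lt_trichotomy c d with h' | h' | h'
  · exact (hd.2 c h' hc.1 h).elim
  · exact h'
  · exact (hc.2 d h' hd.1 fun i => (h i).symm).elim

theorem IsTriple.exists_isFinCode {c : M.Num} (hc : IsTriple c) :
    ∃ d ≤ c, IsFinCode d ∧ ∀ i, MemFin i d ↔ MemFin i c := by
  obtain ⟨d, ⟨hd, hdc⟩, hmin⟩ := bd_exists_least
    (p := fun d => IsTriple d ∧ ∀ i, MemFin i d ↔ MemFin i c)
    (.and (.isTriple (.var 0)) (.sameMembers (.var 0) (.const c))) ⟨hc, fun i => Iff.rfl⟩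
  refine ⟨d, not_lt.1 fun h => hmin c h ⟨hc, fun i => Iff.rfl⟩, ⟨hd, fun d' hd' ht h => ?_⟩, hdc⟩
  exact hmin d' hd' ⟨ht, fun i => (h i).trans (hdc i)⟩

/-- Bounded `Σ⁰₁` comprehension, with a bound on the codes. -/
theorem exists_isFinCode_bound (k : M.Num) : ∃ C, ∀ R : M.Num → M.Num → Prop,
    (Bd M fun e => R (e 0) (e 1)) →
      ∃ c ≤ C, IsFinCode c ∧ ∀ i, MemFin i c ↔ i < k ∧ ∃ a, R i a := by
  obtain ⟨C, hC⟩ := exists_triple_bound k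
  refine ⟨C, fun R hR => ?_⟩
  obtain ⟨c, hcC, hc, h⟩ := hC R hR
  obtain ⟨d, hdc, hd, h'⟩ := hc.exists_isFinCode
  exact ⟨d, hdc.trans hcC, hd, fun i => (h' i).trans (h i)⟩

theorem exists_isFinCode (k : M.Num) {p : M.Num → Prop} (hp : Bd M fun e => p (e 0)) :
    ∃ c, IsFinCode c ∧ ∀ i, MemFin i c ↔ i < k ∧ p i := by
  obtain ⟨C, hC⟩ := exists_isFinCode_bound k
  obtain ⟨c, _, hc, h⟩ := hC (fun i _ => p i) hp
  exact ⟨c, hc, fun i => (h i).trans (and_congr_right fun _ =>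
    ⟨fun ⟨_, h⟩ => h, fun h => ⟨0, h⟩⟩)⟩

/-- The set coded by `d` is definable from `d`, so it has a code below `C`; canonical codes are
unique. -/
theorem IsFinCode.le_bound {k C : M.Num} (hC : ∀ R : M.Num → M.Num → Prop,
    (Bd M fun e => R (e 0) (e 1)) → ∃ c ≤ C, IsFinCode c ∧ ∀ i, MemFin i c ↔ i < k ∧ ∃ a, R i a)
    {d : M.Num} (hd : IsFinCode d) (h : ∀ i, MemFin i d → i < k) : d ≤ C := by
  obtain ⟨c, hcC, hc, h'⟩ := hC (fun i _ => MemFin i d) (.memFin (.var 0) (.const d))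
  rwa [hd.eq_of_memFin_iff hc fun i => Iff.trans
    ⟨fun hi => ⟨h i hi, 0, hi⟩, fun ⟨_, _, hi⟩ => hi⟩ (h' i).symm]

/-- Strong `Σ⁰₁` collection. -/
theorem strong_collection {R : M.Num → M.Num → Prop} (hR : Bd M fun e => R (e 0) (e 1))
    (n : M.Num) : ∃ b, ∀ k < n, (∃ a, R k a) → ∃ a < b, R k a := by
  obtain ⟨C, hC⟩ := exists_isFinCode_bound n
  -- The finite set of those `k` that have a witness is coded by `c`. Asking whether `k` has a
  -- witness thus becomes bounded, and ordinary collection suffices.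
  obtain ⟨c, _, hc, h⟩ := hC R hR
  obtain ⟨b, hb⟩ := bd_collection (R := fun k a => MemFin k c → R k a)
    (.imp (.memFin (.var 0) (.const c)) hR) n fun k hk => by
      by_cases hkc : MemFin k c
      · obtain ⟨_, a, ha⟩ := (h k).1 hkc
        exact ⟨a, fun _ => ha⟩
      · exact ⟨0, fun h => (hkc h).elim⟩
  refine ⟨b, fun k hk hka => ?_⟩
  obtain ⟨a, hab, ha⟩ := hb k hk
  exact ⟨a, hab, ha ((h k).2 ⟨hk, hka⟩)⟩

end FiniteSets

section Strings

variable {M : L2Structure.{u}}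

/-! ## Finite strings -/

theorem IsStringOfLength.exists_entry {σ l i : M.Num} (hσ : IsStringOfLength σ l) (hi : i < l) :
    ∃ a, Entry σ i a := (hσ.2.2 i hi).exists

theorem IsPrefix.trans {σ τ ρ : M.Num} (h : IsPrefix σ τ) (h' : IsPrefix τ ρ) : IsPrefix σ ρ :=
  fun i a hi => h' i a (h i a hi)

variable [hM : Fact M.ModelsRCA0]

theorem Entry.index_lt {σ i a : M.Num} (h : Entry σ i a) : i < σ :=
  (left_le_pair i a).trans_lt (lt_of_memFin h)

theorem Entry.value_lt {σ i a : M.Num} (h : Entry σ i a) : a < σ :=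
  (right_le_pair i a).trans_lt (lt_of_memFin h)

theorem Entry.lt_length {σ i a l : M.Num} (h : Entry σ i a) (hσ : IsStringOfLength σ l) :
    i < l := by
  obtain ⟨i', a', h', hi⟩ := hσ.2.1 _ h
  rwa [(pair_inj.1 h').1]

theorem Entry.unique {σ i a b l : M.Num} (hσ : IsStringOfLength σ l) (ha : Entry σ i a)
    (hb : Entry σ i b) : a = b :=
  (hσ.2.2 i (ha.lt_length hσ)).unique ha hb

theorem IsStringOfLength.length_le {σ l k : M.Num} (hσ : IsStringOfLength σ l)
    (hσ' : IsStringOfLength σ k) : l ≤ k := by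
  by_contra! h
  obtain ⟨a, ha⟩ := hσ.exists_entry h
  exact lt_irrefl _ (ha.lt_length hσ')

theorem IsStringOfLength.length_unique {σ l k : M.Num} (hσ : IsStringOfLength σ l)
    (hσ' : IsStringOfLength σ k) : l = k := (hσ.length_le hσ').antisymm (hσ'.length_le hσ)

theorem IsStringOfLength.length_le_self {σ l : M.Num} (hσ : IsStringOfLength σ l) : l ≤ σ := by
  obtain rfl | ⟨k, rfl⟩ := num_cases l
  · exact num_zero_le σ
  · obtain ⟨a, ha⟩ := hσ.exists_entry (num_lt_self_succ k)
    exact num_lt_iff_add_one_le.1 ha.index_lt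

theorem IsStringOfLength.ext {σ τ l : M.Num} (hσ : IsStringOfLength σ l)
    (hτ : IsStringOfLength τ l) (h : IsPrefix σ τ) : σ = τ := by
  refine hσ.1.eq_of_memFin_iff hτ.1 fun x => ⟨fun hx => ?_, fun hx => ?_⟩
  · obtain ⟨i, a, rfl, _⟩ := hσ.2.1 x hx
    exact h i a hx
  · obtain ⟨i, a, rfl, hi⟩ := hτ.2.1 x hx
    obtain ⟨b, hb⟩ := hσ.exists_entry hi
    rw [Entry.unique hτ hx (h i b hb)]
    exact hb

theorem exists_string {F : M.Num → M.Num → Prop} (hF : Bd M fun e => F (e 0) (e 1)) (l : M.Num)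
    (h : ∀ i < l, ∃! a, F i a) :
    ∃ σ, IsStringOfLength σ l ∧ ∀ i a, Entry σ i a ↔ i < l ∧ F i a := by
  obtain ⟨b, hb⟩ := bd_collection hF l fun i hi => (h i hi).exists
  -- By collection all values lie below `b`, so the whole graph lies below `pair l b`.
  obtain ⟨σ, hσ, hσ'⟩ := exists_isFinCode (pair l b)
    (p := fun x => ∃ i, i ≤ x ∧ ∃ a, a ≤ x ∧ (x = pair i a ∧ i < l ∧ F i a))
    (.bex_le (.var 0) (.bex_le (.var 1) (.and (.eq (.var 2) (.pair (.var 1) (.var 0)))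
      (.and (.lt (.var 1) (.const l)) (hF.subst₂ (.var 1) (.var 0))))))
  have hE : ∀ i a, Entry σ i a ↔ i < l ∧ F i a := by
    intro i a
    refine (hσ' _).trans ⟨?_, fun hi => ⟨?_, i, left_le_pair _ _, a, right_le_pair _ _, rfl, hi⟩⟩
    · rintro ⟨_, i', _, a', _, hx, hi⟩
      obtain ⟨rfl, rfl⟩ := pair_inj.1 hx
      exact hi
    · obtain ⟨a', ha', hFa⟩ := hb i hi.1
      rw [← (h i hi.1).unique hi.2 hFa] at ha'
      exact pair_lt_pair_of_add_lt (add_lt_add hi.1 ha')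
  refine ⟨σ, ⟨hσ, fun x hx => ?_, fun i hi => ?_⟩, hE⟩
  · obtain ⟨_, i, _, a, _, hx, hi, _⟩ := (hσ' x).1 hx
    exact ⟨i, a, hx, hi⟩
  · obtain ⟨a, ha, hu⟩ := h i hi
    exact ⟨a, (hE i a).2 ⟨hi, ha⟩, fun b hb => hu b ((hE i b).1 hb).2⟩

theorem Bd.entry {s t r : (ℕ → M.Num) → M.Num} (hs : Tm M s) (ht : Tm M t) (hr : Tm M r) :
    Bd M fun e => Entry (s e) (t e) (r e) := .memFin (.pair ht hr) hs

theorem Bd.isStringOfLength {s t : (ℕ → M.Num) → M.Num} (hs : Tm M s) (ht : Tm M t) :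
    Bd M fun e => IsStringOfLength (s e) (t e) := by
  refine Bd.subst₂ (R := fun s t => IsStringOfLength s t) ?_ hs ht
  refine (Bd.and (.isFinCode (.var 0)) (.and
    (.ball (.var 0) (Q := fun e x => MemFin x (e 0) → ∃ i, i ≤ x ∧ ∃ a, a ≤ x ∧
      (x = L2Structure.pair i a ∧ i < e 1))
      (.imp (.memFin (.var 0) (.var 1)) (.bex_le (.var 0) (.bex_le (.var 1) (.and
        (.eq (.var 2) (.pair (.var 1) (.var 0))) (.lt (.var 1) (.var 4)))))))
    (.ball (.var 1) (Q := fun e i => ∃ a, a < e 0 ∧ (Entry (e 0) i a ∧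
      ∀ b, b < e 0 → Entry (e 0) i b → b = a))
      (.bex (.var 1) (.and (.entry (.var 2) (.var 1) (.var 0)) (.ball (.var 2)
        (.imp (.entry (.var 3) (.var 2) (.var 0)) (.eq (.var 0) (.var 1))))))))).congr fun e => ?_
  refine and_congr_right fun _ => and_congr ⟨fun h x _ hx => ?_, fun h x hx => ?_⟩
    (forall₂_congr fun i _ => ⟨?_, ?_⟩)
  · obtain ⟨i, a, rfl, hi⟩ := h x hx
    exact ⟨i, left_le_pair _ _, a, right_le_pair _ _, rfl, hi⟩
  · obtain ⟨i, _, a, _, hx, hi⟩ := h x (lt_of_memFin hx) hx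
    exact ⟨i, a, hx, hi⟩
  · rintro ⟨a, ha, h⟩
    exact ⟨a, ha.value_lt, ha, fun b _ => h b⟩
  · rintro ⟨a, _, ha, h⟩
    exact ⟨a, ha, fun b hb => h b hb.value_lt hb⟩

theorem Bd.isPrefix {s t : (ℕ → M.Num) → M.Num} (hs : Tm M s) (ht : Tm M t) :
    Bd M fun e => IsPrefix (s e) (t e) := by
  refine Bd.subst₂ (R := fun s t => IsPrefix s t) ?_ hs ht
  exact (Bd.ball (.var 0) (Q := fun e i => ∀ a, a < e 0 → Entry (e 0) i a → Entry (e 1) i a)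
    (.ball (.var 1) (.imp (.entry (.var 2) (.var 1) (.var 0))
      (.entry (.var 3) (.var 1) (.var 0))))).congr fun e =>
      ⟨fun h i _ a _ => h i a, fun h i a hi => h i hi.index_lt a hi.value_lt hi⟩

theorem IsPrefix.length_le {σ τ k l : M.Num} (h : IsPrefix σ τ) (hσ : IsStringOfLength σ k)
    (hτ : IsStringOfLength τ l) : k ≤ l := by
  by_contra! hlt
  obtain ⟨a, ha⟩ := hσ.exists_entry hlt
  exact lt_irrefl _ ((h _ _ ha).lt_length hτ)

theorem IsPrefix.entry_of_lt {σ τ k l i a : M.Num} (h : IsPrefix σ τ) (hσ : IsStringOfLength σ k)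
    (hτ : IsStringOfLength τ l) (hi : i < k) (ha : Entry τ i a) : Entry σ i a := by
  obtain ⟨b, hb⟩ := hσ.exists_entry hi
  rwa [Entry.unique hτ ha (h i b hb)]

theorem IsStringOfLength.exists_restrict {σ l k : M.Num} (hσ : IsStringOfLength σ l)
    (hk : k ≤ l) :
    ∃ τ, IsStringOfLength τ k ∧ IsPrefix τ σ ∧ ∀ i a, Entry τ i a ↔ i < k ∧ Entry σ i a := by
  obtain ⟨τ, hτ, h⟩ := exists_string (F := fun i a => Entry σ i a)
    (.entry (.const σ) (.var 0) (.var 1)) k fun i hi => hσ.2.2 i (hi.trans_le hk)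
  exact ⟨τ, hτ, fun i a hi => ((h i a).1 hi).2, h⟩

theorem IsStringOfLength.exists_append {σ l : M.Num} (hσ : IsStringOfLength σ l) (a : M.Num) :
    ∃ τ, IsStringOfLength τ (l + 1) ∧ IsPrefix σ τ ∧ Entry τ l a := by
  obtain ⟨τ, hτ, h⟩ := exists_string
    (F := fun i b => (i < l ∧ Entry σ i b) ∨ (i = l ∧ b = a))
    (.or (.and (.lt (.var 0) (.const l)) (.entry (.const σ) (.var 0) (.var 1)))
      (.and (.eq (.var 0) (.const l)) (.eq (.var 1) (.const a)))) (l + 1) fun i hi => by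
      rcases (num_lt_succ _ _).1 hi with hi | rfl
      · obtain ⟨b, hb, hu⟩ := hσ.2.2 i hi
        exact ⟨b, .inl ⟨hi, hb⟩, fun c hc => hc.elim (fun hc => hu c hc.2)
          fun hc => absurd hc.1 hi.ne⟩
      · exact ⟨a, .inr ⟨rfl, rfl⟩, fun c hc => hc.elim (fun hc => absurd hc.1 (lt_irrefl _))
          fun hc => hc.2⟩
  exact ⟨τ, hτ, fun i b hb => (h i b).2 ⟨(hb.lt_length hσ).trans (num_lt_self_succ l),
    .inl ⟨hb.lt_length hσ, hb⟩⟩, (h l a).2 ⟨num_lt_self_succ l, .inr ⟨rfl, rfl⟩⟩⟩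

theorem IsAppend.entry {σ τ a l : M.Num} (h : IsAppend σ a τ) (hσ : IsStringOfLength σ l) :
    IsStringOfLength τ (l + 1) ∧ IsPrefix σ τ ∧ Entry τ l a := by
  obtain ⟨k, hσ', hτ, hp, ha⟩ := h
  obtain rfl := hσ.length_unique hσ'
  exact ⟨hτ, hp, ha⟩

theorem IsStringOfLength.append_unique {σ τ τ' a l : M.Num} (hσ : IsStringOfLength σ l)
    (hτ : IsAppend σ a τ) (hτ' : IsAppend σ a τ') : τ = τ' := by
  obtain ⟨hl, hp, ha⟩ := hτ.entry hσ
  obtain ⟨hl', hp', ha'⟩ := hτ'.entry hσ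
  refine hl.ext hl' fun i b hb => ?_
  rcases (num_lt_succ _ _).1 (hb.lt_length hl) with hi | rfl
  · exact hp' _ _ (hp.entry_of_lt hσ hl hi hb)
  · rwa [Entry.unique hl hb ha]

theorem exists_string_bound (L b : M.Num) : ∃ C, ∀ σ l, IsStringOfLength σ l → l ≤ L →
    (∀ i a, Entry σ i a → a < b) → σ ≤ C := by
  obtain ⟨C, hC⟩ := exists_isFinCode_bound (pair L b)
  refine ⟨C, fun σ l hσ hl h => hσ.1.le_bound hC fun x hx => ?_⟩
  obtain ⟨i, a, rfl, hi⟩ := hσ.2.1 x hx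
  exact pair_lt_pair_of_add_lt (add_lt_add (hi.trans_le hl) (h i a hx))

end Strings

section ModulusTree

variable {M : L2Structure.{u}}

/-! ## Ramsey-type König's lemma implies `Σ⁰₁` comprehension -/

/-- Below `l`, the number `s` bounds a witness of `∃ m, R x m` for every `x ≤ i` that has a witness
below `l`. -/
def BoundsWitnesses (R : M.Num → M.Num → Prop) (l i s : M.Num) : Prop :=
  ∀ x, x < i + 1 → ∀ m, m < l → R x m → ∃ m', m' < s ∧ R x m'

/-- `s` is the successor of the least witness of `∃ m, R i m`. -/
def IsLeastWitnessSucc (R : M.Num → M.Num → Prop) (i s : M.Num) : Prop :=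
  ∃ m, m < s ∧ (s = m + 1 ∧ R i m ∧ ∀ m', m' < m → ¬ R i m')

/-- `s` is the entry of `σ` before the index `i` (or zero, if `i` is). -/
def IsPreviousEntry (σ i s : M.Num) : Prop :=
  i = 0 ∧ s = 0 ∨ ∃ j, j < i ∧ (i = j + 1 ∧ Entry σ j s)

/-- The tree of approximations to a modulus for the relation `∃ m, R x m`. -/
def modulusTree (R : M.Num → M.Num → Prop) : Set M.Num :=
  {σ | ∃ l, IsStringOfLength σ l ∧ ∀ i, i < l → ∀ s, s < σ → Entry σ i s →
    BoundsWitnesses R l i s ∧ (IsLeastWitnessSucc R i s ∨ IsPreviousEntry σ i s)}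

theorem Bd.boundsWitnesses {R : M.Num → M.Num → Prop} (hR : Bd M fun e => R (e 0) (e 1))
    {l i s : (ℕ → M.Num) → M.Num} (hl : Tm M l) (hi : Tm M i) (hs : Tm M s) :
    Bd M fun e => BoundsWitnesses R (l e) (i e) (s e) :=
  Bd.subst₃ (R := BoundsWitnesses R) (.ball (.add (.var 1) (.const 1)) (.ball (.var 1)
    (.imp (hR.subst₂ (.var 1) (.var 0)) (.bex (.var 4) (hR.subst₂ (.var 2) (.var 0)))))) hl hi hs

theorem Bd.isLeastWitnessSucc {R : M.Num → M.Num → Prop} (hR : Bd M fun e => R (e 0) (e 1))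
    {i s : (ℕ → M.Num) → M.Num} (hi : Tm M i) (hs : Tm M s) :
    Bd M fun e => IsLeastWitnessSucc R (i e) (s e) :=
  Bd.subst₂ (R := IsLeastWitnessSucc R) (.bex (.var 1) (.and (.eq (.var 2) (.add (.var 0)
    (.const 1))) (.and (hR.subst₂ (.var 1) (.var 0)) (.ball (.var 0)
      (.not (hR.subst₂ (.var 2) (.var 0))))))) hi hs

variable [hM : Fact M.ModelsRCA0]

theorem Bd.isPreviousEntry {σ i s : (ℕ → M.Num) → M.Num} (hσ : Tm M σ) (hi : Tm M i)
    (hs : Tm M s) : Bd M fun e => IsPreviousEntry (σ e) (i e) (s e) :=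
  Bd.subst₃ (R := IsPreviousEntry) (.or (.and (.eq (.var 1) (.const 0)) (.eq (.var 2) (.const 0)))
    (.bex (.var 1) (.and (.eq (.var 2) (.add (.var 0) (.const 1)))
      (.entry (.var 1) (.var 0) (.var 3))))) hσ hi hs

theorem IsLeastWitnessSucc.unique {R : M.Num → M.Num → Prop} {i s t : M.Num}
    (hs : IsLeastWitnessSucc R i s) (ht : IsLeastWitnessSucc R i t) : s = t := by
  obtain ⟨m, _, rfl, hm, hm'⟩ := hs
  obtain ⟨n, _, rfl, hn, hn'⟩ := ht
  rw [le_antisymm (not_lt.1 fun h => hm' n h hn) (not_lt.1 fun h => hn' m h hm)]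

theorem IsPreviousEntry.unique {σ l i s t : M.Num} (hσ : IsStringOfLength σ l)
    (hs : IsPreviousEntry σ i s) (ht : IsPreviousEntry σ i t) : s = t := by
  rcases hs with ⟨rfl, rfl⟩ | ⟨j, hj, rfl, hs⟩
  · rcases ht with ⟨_, rfl⟩ | ⟨k, hk, _, ht⟩
    exacts [rfl, (num_not_lt_zero k hk).elim]
  · rcases ht with ⟨h, _⟩ | ⟨k, _, hjk, ht⟩
    · rw [h] at hj
      exact (num_not_lt_zero j hj).elim
    · rw [← add_right_cancel hjk] at ht
      exact hs.unique hσ ht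

theorem IsPreviousEntry.restrict {σ τ k l i s : M.Num} (hτσ : IsPrefix τ σ)
    (hτ : IsStringOfLength τ k) (hσ : IsStringOfLength σ l) (hi : i ≤ k)
    (h : IsPreviousEntry σ i s) : IsPreviousEntry τ i s := by
  rcases h with h | ⟨j, hj, rfl, hs⟩
  · exact .inl h
  · exact .inr ⟨j, hj, rfl, hτσ.entry_of_lt hτ hσ (hj.trans_le hi) hs⟩

/-- Membership is a bounded condition: a string's length is at most its code, and its entries are
below its code. -/
theorem modulusTree_mem_sets {R : M.Num → M.Num → Prop} (hR : Bd M fun e => R (e 0) (e 1)) :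
    modulusTree R ∈ M.sets := by
  refine hM.out.bd_comprehension (Bd.congr (.bex_le (.var 0) (Q := fun e l =>
    IsStringOfLength (e 0) l ∧ ∀ i, i < l → ∀ s, s < e 0 → Entry (e 0) i s →
      BoundsWitnesses R l i s ∧ (IsLeastWitnessSucc R i s ∨ IsPreviousEntry (e 0) i s))
    (.and (.isStringOfLength (.var 1) (.var 0)) (.ball (.var 0) (.ball (.var 2)
      (.imp (.entry (.var 3) (.var 1) (.var 0)) (.and (.boundsWitnesses hR (.var 2) (.var 1)
        (.var 0)) (.or (.isLeastWitnessSucc hR (.var 1) (.var 0))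
          (.isPreviousEntry (.var 3) (.var 1) (.var 0)))))))))
    fun e => ⟨fun ⟨l, h⟩ => ⟨l, h.1.length_le_self, h⟩, fun ⟨l, _, h⟩ => ⟨l, h⟩⟩)

/-- A shorter string has fewer witnesses to account for, and the previous entry of a prefix is that
of the full string. -/
theorem modulusTree_isTree (R : M.Num → M.Num → Prop) : IsTree (modulusTree R) := by
  refine ⟨fun σ ⟨l, hσ, _⟩ => ⟨l, hσ⟩, fun σ ⟨l, hσ, h⟩ τ ⟨k, hτ⟩ hτσ => ⟨k, hτ, ?_⟩⟩
  have hkl := hτσ.length_le hτ hσ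
  intro i hi s _ hs
  have hs' := hτσ i s hs
  obtain ⟨h₁, h₂⟩ := h i (hi.trans_le hkl) s hs'.value_lt hs'
  exact ⟨fun x hx m hm => h₁ x hx m (hm.trans_le hkl),
    h₂.imp_right fun h => h.restrict hτσ hτ hσ hi.le⟩

/-- The next entry is either the previous entry of `σ` or the successor of the least witness at the
new index. Each is unique when it exists, so two of any three successors coincide. -/
theorem modulusTree_isTwoBranching (R : M.Num → M.Num → Prop) :
    IsTwoBranching (modulusTree R) := by
  rintro σ ⟨l, hσ, _⟩ τ₁ h₁ τ₂ h₂ τ₃ h₃ ⟨a₁, ha₁⟩ ⟨a₂, ha₂⟩ ⟨a₃, ha₃⟩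
  have key : ∀ τ ∈ modulusTree R, ∀ a, IsAppend σ a τ →
      IsLeastWitnessSucc R l a ∨ IsPreviousEntry σ l a := by
    rintro τ ⟨k, hτ, h⟩ a ha
    obtain ⟨hτ', hp, ha⟩ := ha.entry hσ
    obtain rfl := hτ'.length_unique hτ
    exact (h l (num_lt_self_succ l) a ha.value_lt ha).2.imp_right fun h =>
      h.restrict hp hσ hτ le_rfl
  have huniq : a₁ = a₂ ∨ a₁ = a₃ ∨ a₂ = a₃ := by
    rcases key _ h₁ _ ha₁ with k₁ | k₁ <;> rcases key _ h₂ _ ha₂ with k₂ | k₂ <;>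
      rcases key _ h₃ _ ha₃ with k₃ | k₃
    exacts [.inl (k₁.unique k₂), .inl (k₁.unique k₂), .inr (.inl (k₁.unique k₃)),
      .inr (.inr (k₂.unique hσ k₃)), .inr (.inr (k₂.unique k₃)), .inr (.inl (k₁.unique hσ k₃)),
      .inl (k₁.unique hσ k₂), .inl (k₁.unique hσ k₂)]
  rcases huniq with rfl | rfl | rfl
  · exact .inl (hσ.append_unique ha₁ ha₂)
  · exact .inr (.inl (hσ.append_unique ha₁ ha₃))
  · exact .inr (.inr (hσ.append_unique ha₂ ha₃))

theorem modulusTree_isInfinite {R : M.Num → M.Num → Prop} (hR : Bd M fun e => R (e 0) (e 1)) :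
    IsInfinite fun σ => σ ∈ modulusTree R := by
  intro b
  -- A code is at least the length of its string, so length `b + 1` puts the code above `b`.
  set l := b + 1 with hl
  have hG : Bd M fun e => BoundsWitnesses R l (e 0) (e 1) :=
    .boundsWitnesses hR (.const l) (.var 0) (.var 1)
  -- The entry at `i` is the least admissible bound; `l` itself is always admissible.
  obtain ⟨σ, hσ, hE⟩ := exists_string
    (F := fun i s => BoundsWitnesses R l i s ∧ ∀ t, t < s → ¬ BoundsWitnesses R l i t)
    (.and hG (.ball (.var 1) (.not (.boundsWitnesses hR (.const l) (.var 1) (.var 0))))) l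
    (fun i _ => by
      obtain ⟨s, hs, hmin⟩ := bd_exists_least (p := fun s => BoundsWitnesses R l i s)
        (.boundsWitnesses hR (.const l) (.const i) (.var 0)) (n := l) fun x _ m hm hx => ⟨m, hm, hx⟩
      exact ⟨s, ⟨hs, hmin⟩, fun t ht => le_antisymm (not_lt.1 fun h => ht.2 s h hs)
        (not_lt.1 fun h => hmin t h ht.1)⟩)
  refine ⟨σ, num_lt_iff_add_one_le.2 hσ.length_le_self, l, hσ, fun i hi s _ hs => ?_⟩
  obtain ⟨_, hs, hmin⟩ := (hE i s).1 hs
  refine ⟨hs, ?_⟩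
  -- If `m + 1` is the least bound, then `m` fails because of some x ≤ i, and `m` is exactly the
  -- least witness for that x.
  have new : ∀ m, s = m + 1 → (∃ x, x < i + 1 ∧ R x m ∧ ∀ m', m' < m → ¬ R x m') := by
    rintro m rfl
    have := hmin m (num_lt_self_succ m)
    unfold BoundsWitnesses at this
    push Not at this
    obtain ⟨x, hx, n, hn, hxn, h⟩ := this
    obtain ⟨m', hm', hxm'⟩ := hs x hx n hn hxn
    rcases (num_lt_succ _ _).1 hm' with hm' | rfl
    · exact (h m' hm' hxm').elim
    · exact ⟨x, hx, hxm', h⟩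
  obtain rfl | ⟨m, rfl⟩ := num_cases s
  · obtain rfl | ⟨j, rfl⟩ := num_cases i
    · exact .inr (.inl ⟨rfl, rfl⟩)
    · refine .inr (.inr ⟨j, num_lt_self_succ j, rfl, (hE j 0).2
        ⟨(num_lt_self_succ j).trans hi, fun x hx m hm hxm => ?_, fun t ht =>
          (num_not_lt_zero t ht).elim⟩⟩)
      exact hs x (hx.trans (num_lt_self_succ _)) m hm hxm
  · obtain ⟨x, hx, hxm, hxm'⟩ := new m rfl
    -- If x < i, the same value is already needed at i - 1 and so is the previous entry there; if x
    -- = i, it is the successor of the least witness at `i`.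
    rcases (num_lt_succ _ _).1 hx with hx | rfl
    · obtain rfl | ⟨j, rfl⟩ := num_cases i
      · exact (num_not_lt_zero x hx).elim
      refine .inr (.inr ⟨j, num_lt_self_succ j, rfl, (hE j (m + 1)).2
        ⟨(num_lt_self_succ j).trans hi, fun y hy n hn hyn => ?_, fun t ht h => ?_⟩⟩)
      · exact hs y (hy.trans (num_lt_self_succ _)) n hn hyn
      · have hml : m < l := by
          by_contra! hml
          refine hmin m (num_lt_self_succ m) fun y _ n hn hyn => ⟨n, hn.trans_le hml, hyn⟩
        obtain ⟨n, hn, hxn⟩ := h x hx m hml hxm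
        exact hxm' n (hn.trans_le (lt_add_one_iff_le.1 ht)) hxn
    · exact .inl ⟨m, num_lt_self_succ m, rfl, hxm, hxm'⟩

/-- Along a string, each entry is 0, copied from before, or the successor of a least witness at an
index below `L`. Strong collection bounds all those least witnesses at once, without deciding which
indices have one. Hence infinitely many strings of the tree must include arbitrarily long ones. -/
theorem modulusTree_bounded_of_length_le {R : M.Num → M.Num → Prop}
    (hR : Bd M fun e => R (e 0) (e 1)) (L : M.Num) :
    ∃ C, ∀ σ ∈ modulusTree R, ∀ l, IsStringOfLength σ l → l ≤ L → σ ≤ C := by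
  obtain ⟨b, hb⟩ := strong_collection hR L
  obtain ⟨C, hC⟩ := exists_string_bound L (b + 1)
  refine ⟨C, ?_⟩
  rintro σ ⟨_, hσ', h⟩ l hσ hl
  obtain rfl := hσ'.length_unique hσ
  have hleast : ∀ i s, i < L → IsLeastWitnessSucc R i s → s < b + 1 := by
    rintro i s hi ⟨m, _, rfl, hm, hmin⟩
    obtain ⟨m', hm'b, hm'⟩ := hb i hi ⟨m, hm⟩
    exact num_succ_lt_succ ((not_lt.1 fun h => hmin m' h hm').trans_lt hm'b)
  have key : ∀ i, ∀ s, s < σ → Entry σ i s → s < b + 1 := by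
    refine bd_strong_induction (.ball (.const σ) (.imp (.entry (.const σ) (.var 1) (.var 0))
      (.lt (.var 0) (.const _)))) fun i ih s hsσ hs => ?_
    have hi := hs.lt_length hσ
    rcases (h i hi s hsσ hs).2 with hs' | ⟨_, rfl⟩ | ⟨j, hj, _, hs'⟩
    · exact hleast i s (hi.trans_le hl) hs'
    · exact num_zero_lt_succ b
    · exact ih j hj s hsσ hs'
  exact hC σ _ hσ hl fun i a ha => key i a ha.value_lt ha

theorem sigma_comprehension_of_homogeneous {R : M.Num → M.Num → Prop}
    (hR : Bd M fun e => R (e 0) (e 1)) (hT : HasInfiniteHomogeneous (modulusTree R)) :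
    {x | ∃ m, R x m} ∈ M.sets := by
  obtain ⟨h, hh, D, _, ⟨_, _, hdom⟩, hinf, hhom⟩ := hT
  have key : ∀ n a, pair n a ∈ h → ∀ x, x ≤ n → ∀ m, R x m → ∃ m', m' < a ∧ R x m' := by
    intro n a hna x hx m hxm
    -- A homogeneous string with code above `C` is longer than both `n` and `m`, so its entry `a` at
    -- `n` has to account for the witness `m`.
    obtain ⟨C, hC⟩ := modulusTree_bounded_of_length_le hR (max n m)
    obtain ⟨σ, hσC, hσT, hσh⟩ := hhom C
    obtain ⟨l, hσ, hl⟩ := hσT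
    have hlt : max n m < l := by
      by_contra! hle
      exact absurd hσC (not_lt.2 (hC σ ⟨l, hσ, hl⟩ l hσ hle))
    have hE := hσh n a l hna hσ ((le_max_left _ _).trans_lt hlt)
    exact (hl n ((le_max_left _ _).trans_lt hlt) a hE.value_lt hE).1 x
      (lt_add_one_iff_le.2 hx) m ((le_max_right _ _).trans_lt hlt) hxm
  -- The Π⁰₁ definition: every pair (n, a) in `h` with x ≤ n bounds a witness for x. The single
  -- universal variable `z` carries the pair.
  refine hM.out.delta_comprehension (S := fun x z => ∀ n, n ≤ z → ∀ a, a ≤ z → z = pair n a →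
      z ∈ h → x ≤ n → ∃ m', m' < a ∧ R x m') hR
    (.ball_le (.var 1) (.ball_le (.var 2) (.imp (.eq (.var 3) (.pair (.var 1) (.var 0)))
      (.imp (.mem (.var 3) hh) (.imp (.le (.var 2) (.var 1)) (.bex (.var 0)
        (hR.subst₂ (.var 3) (.var 0)))))))) fun x => ⟨?_, fun hx => ?_⟩
  · rintro ⟨m, hm⟩ z n _ a _ rfl hz hxn
    exact key n a hz x hxn m hm
  · obtain ⟨n, hxn, hn⟩ := hinf x
    obtain ⟨a, ha⟩ := (hdom n).1 hn
    obtain ⟨m, _, hm⟩ := hx (pair n a) n (left_le_pair _ _) a (right_le_pair _ _) rfl ha hxn.le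
    exact ⟨m, hm⟩

/-- `M` satisfies comprehension for `Σ⁰₁` relations with parameters. -/
def SigmaComprehension (M : L2Structure.{u}) : Prop :=
  ∀ R : M.Num → M.Num → Prop, (Bd M fun e => R (e 0) (e 1)) → {x | ∃ m, R x m} ∈ M.sets

theorem ModelsRKLTwoBranching.sigmaComprehension (h : M.ModelsRKLTwoBranching) :
    M.SigmaComprehension := fun R hR => sigma_comprehension_of_homogeneous hR <|
  h _ (modulusTree_mem_sets hR) (modulusTree_isTree R) (modulusTree_isInfinite hR)
    (modulusTree_isTwoBranching R)

end ModulusTree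

section ArithmeticalComprehension

variable {M : L2Structure.{u}}

/-! ## `Σ⁰₁` comprehension implies arithmetical comprehension -/

theorem Tm.exists_dependence {t : (ℕ → M.Num) → M.Num} (ht : Tm M t) :
    ∃ k : ℕ, ∀ e e', (∀ i < k, e i = e' i) → t e = t e' := by
  induction ht with
  | var i => exact ⟨i + 1, fun e e' h => h i i.lt_succ_self⟩
  | const a => exact ⟨0, fun _ _ _ => rfl⟩
  | add _ _ ih₁ ih₂ =>
    obtain ⟨k, h⟩ := ih₁
    obtain ⟨k', h'⟩ := ih₂
    refine ⟨max k k', fun e e' he => ?_⟩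
    beta_reduce
    rw [h e e' fun i hi => he i (lt_max_of_lt_left hi),
      h' e e' fun i hi => he i (lt_max_of_lt_right hi)]
  | mul _ _ ih₁ ih₂ =>
    obtain ⟨k, h⟩ := ih₁
    obtain ⟨k', h'⟩ := ih₂
    refine ⟨max k k', fun e e' he => ?_⟩
    beta_reduce
    rw [h e e' fun i hi => he i (lt_max_of_lt_left hi),
      h' e e' fun i hi => he i (lt_max_of_lt_right hi)]

theorem extend_eq_of_lt {e e' : ℕ → M.Num} {k : ℕ} (h : ∀ i < k, e i = e' i) (a : M.Num) :
    ∀ i < k + 1, extend a e i = extend a e' i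
  | 0, _ => rfl
  | i + 1, hi => h i (Nat.lt_of_succ_lt_succ hi)

/-- Only finitely many variables matter, so they can be packed into one number before comprehension
is applied. -/
theorem Bd.exists_dependence {P : (ℕ → M.Num) → Prop} (hP : Bd M P) :
    ∃ k : ℕ, ∀ e e', (∀ i < k, e i = e' i) → (P e ↔ P e') := by
  induction hP with
  | eq h₁ h₂ | lt h₁ h₂ =>
    obtain ⟨k, h⟩ := h₁.exists_dependence
    obtain ⟨k', h'⟩ := h₂.exists_dependence
    refine ⟨max k k', fun e e' he => ?_⟩
    beta_reduce
    rw [h e e' fun i hi => he i (lt_max_of_lt_left hi),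
      h' e e' fun i hi => he i (lt_max_of_lt_right hi)]
  | mem ht hA =>
    obtain ⟨k, h⟩ := ht.exists_dependence
    exact ⟨k, fun e e' he => by beta_reduce; rw [h e e' he]⟩
  | not _ ih =>
    obtain ⟨k, h⟩ := ih
    exact ⟨k, fun e e' he => not_congr (h e e' he)⟩
  | and _ _ ih₁ ih₂ =>
    obtain ⟨k, h⟩ := ih₁
    obtain ⟨k', h'⟩ := ih₂
    exact ⟨max k k', fun e e' he => and_congr (h e e' fun i hi => he i (lt_max_of_lt_left hi))
      (h' e e' fun i hi => he i (lt_max_of_lt_right hi))⟩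
  | all_lt ht _ ih =>
    obtain ⟨k, h⟩ := ht.exists_dependence
    obtain ⟨k', h'⟩ := ih
    refine ⟨max k k', fun e e' he => ?_⟩
    beta_reduce
    rw [h e e' fun i hi => he i (lt_max_of_lt_left hi)]
    refine forall₂_congr fun a _ => h' _ _ fun i hi => ?_
    exact extend_eq_of_lt (fun i hi => he i (lt_max_of_lt_right hi)) a i
      (hi.trans k'.lt_succ_self)

theorem ModelsACA0.sigmaComprehension (h : M.ModelsACA0) : M.SigmaComprehension :=
  fun _ hR => h.sigma_comprehension hR

/-- `σ` belongs to `T` and has infinitely many extensions in `T`. -/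
def Extendible (T : Set M.Num) (σ : M.Num) : Prop :=
  σ ∈ T ∧ ∀ b, ∃ τ, b < τ ∧ (τ ∈ T ∧ IsPrefix σ τ)

theorem Extendible.of_isPrefix {T : Set M.Num} (hT : IsTree T) {σ τ : M.Num}
    (hσ : Extendible T σ) (hτ : IsString τ) (h : IsPrefix τ σ) : Extendible T τ :=
  ⟨hT.2 σ hσ.1 τ hτ h, fun b => let ⟨ρ, hb, hρ, hp⟩ := hσ.2 b; ⟨ρ, hb, hρ, h.trans hp⟩⟩

variable [hM : Fact M.ModelsRCA0]

/-- Induction on the number `k` of free variables besides the quantified one. With none, the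
statement is a fixed truth value; with one, it is membership in a set supplied by comprehension,
hence atomic; with more, the first two are replaced by their pair. -/
theorem SigmaComprehension.bd_ex_of_dependence (hS : M.SigmaComprehension) (k : ℕ)
    {P : (ℕ → M.Num) → Prop} (hP : Bd M P)
    (hk : ∀ e e', (∀ i < k + 1, e i = e' i) → (P e ↔ P e')) :
    Bd M fun e => ∃ a, P (extend a e) := by
  induction k generalizing P with
  | zero =>
    refine (Bd.const M (∃ a, P (extend a fun _ => 0))).congr fun e => exists_congr fun a => ?_
    exact hk _ _ (extend_eq_of_lt (fun i hi => absurd hi i.not_lt_zero) a)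
  | succ k ih =>
    cases k with
    | zero =>
      have hX := hS (fun x m => P (extend m fun _ => x)) <|
        (hP.subst (s := fun i => match i with
            | 0 => fun e => e 1
            | _ + 1 => fun e => e 0)
          fun i => match i with
            | 0 => .var 1
            | _ + 1 => .var 0).congr fun e => by
          have : (extend (e 1) fun _ => e 0) = fun i => (match i with
            | 0 => fun e => e 1
            | _ + 1 => fun e => e 0 : (ℕ → M.Num) → M.Num) e := by
            funext i; cases i <;> rfl
          rw [this]
      refine (Bd.mem (.var 0) hX).congr fun e => exists_congr fun a => hk _ _ ?_
      refine extend_eq_of_lt (fun i hi => ?_) a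
      rw [Nat.lt_one_iff.1 hi]
    | succ k =>
      -- Here `e 0` is the quantified variable and `e 1` the pair that stands for the first two free
      -- ones.
      let P' : (ℕ → M.Num) → Prop := fun e => ∃ x, x ≤ e 1 ∧ ∃ y, y ≤ e 1 ∧
        (e 1 = pair x y ∧ P (extend (e 0) (extend x (extend y fun i => e (i + 2)))))
      have hP' : Bd M P' := by
        refine .bex_le (.var 1) (.bex_le (.var 2) (.and (.eq (.var 3) (.pair (.var 1) (.var 0))) ?_))
        let s : ℕ → (ℕ → M.Num) → M.Num := fun i => match i with
          | 0 => fun e => e 2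
          | 1 => fun e => e 1
          | 2 => fun e => e 0
          | i + 3 => fun e => e (i + 4)
        refine (hP.subst (s := s) fun i => match i with
          | 0 => .var 2
          | 1 => .var 1
          | 2 => .var 0
          | i + 3 => .var (i + 4)).congr fun e => ?_
        have : (fun i => s i e) =
            extend (e 2) (extend (e 1) (extend (e 0) fun i => e (i + 4))) := by
          funext i
          match i with
          | 0 => rfl
          | 1 => rfl
          | 2 => rfl
          | i + 3 => rfl
        rw [this]
      have hdep : ∀ e e', (∀ i < k + 1 + 1, e i = e' i) → (P' e ↔ P' e') := by
        intro e e' he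
        have h₁ : e 1 = e' 1 := he 1 (by omega)
        have h₀ : e 0 = e' 0 := he 0 (by omega)
        simp only [P', h₁, h₀]
        refine exists_congr fun x => and_congr_right fun _ => exists_congr fun y =>
          and_congr_right fun _ => and_congr_right fun _ => hk _ _ ?_
        exact extend_eq_of_lt (extend_eq_of_lt (extend_eq_of_lt
          (fun i hi => he _ (by omega)) _) _) _
      let s : ℕ → (ℕ → M.Num) → M.Num := fun i => match i with
        | 0 => fun e => pair (e 0) (e 1)
        | i + 1 => fun e => e (i + 2)
      refine ((ih hP' hdep).subst (s := s) fun i => match i with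
        | 0 => .pair (.var 0) (.var 1)
        | i + 1 => .var (i + 2)).congr fun e => exists_congr fun a => ?_
      have he : extend a e = extend a (extend (e 0) (extend (e 1) fun i => e (i + 2))) := by
        funext i
        match i with
        | 0 => rfl
        | 1 => rfl
        | 2 => rfl
        | i + 3 => rfl
      rw [he]
      constructor
      · exact fun h => ⟨e 0, left_le_pair _ _, e 1, right_le_pair _ _, rfl, h⟩
      · rintro ⟨x, _, y, _, hxy, h⟩
        obtain ⟨hx, hy⟩ := pair_inj.1 hxy
        rw [hx, hy]
        exact h

theorem SigmaComprehension.bd_ex (hS : M.SigmaComprehension)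
    {Q : (ℕ → M.Num) → M.Num → Prop} (hQ : Bd M fun e => Q (fun i => e (i + 1)) (e 0)) :
    Bd M fun e => ∃ a, Q e a := by
  obtain ⟨k, hk⟩ := hQ.exists_dependence
  exact hS.bd_ex_of_dependence k hQ fun e e' h => hk e e' fun i hi => h i (hi.trans k.lt_succ_self)

theorem SigmaComprehension.bd_all (hS : M.SigmaComprehension)
    {Q : (ℕ → M.Num) → M.Num → Prop} (hQ : Bd M fun e => Q (fun i => e (i + 1)) (e 0)) :
    Bd M fun e => ∀ a, Q e a :=
  (hS.bd_ex (Q := fun e a => ¬ Q e a) hQ.not).not.congr fun e => by push Not; rfl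

theorem SigmaComprehension.bd_sat (hS : M.SigmaComprehension) (φ : ArithFormula)
    (E : ℕ → M.sets) : Bd M fun e => M.Sat E φ e := by
  have hTm : ∀ t : L2Term, Tm M fun e => M.eval e t := fun t => by
    induction t with
    | var i => exact .var i
    | zero => exact .const 0
    | one => exact .const 1
    | add _ _ ih₁ ih₂ => exact .add ih₁ ih₂
    | mul _ _ ih₁ ih₂ => exact .mul ih₁ ih₂
  induction φ with
  | eq s t => exact .eq (hTm s) (hTm t)
  | lt s t => exact .lt (hTm s) (hTm t)
  | mem t i => exact .mem (hTm t) (E i).2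
  | not φ ih => exact .not ih
  | and φ ψ ih₁ ih₂ => exact .and ih₁ ih₂
  | or φ ψ ih₁ ih₂ => exact .or ih₁ ih₂
  | imp φ ψ ih₁ ih₂ => exact .imp ih₁ ih₂
  | ballLT t φ ih => exact .all_lt (hTm t) ih
  | bexLT t φ ih =>
    exact .bex (Q := fun e a => M.Sat E φ (extend a e)) (hTm t)
      (ih.congr fun e => by rw [show extend (e 0) (fun i => e (i + 1)) = e from
        funext fun i => by cases i <;> rfl])
  | all φ ih =>
    exact hS.bd_all (Q := fun e a => M.Sat E φ (extend a e))
      (ih.congr fun e => by rw [show extend (e 0) (fun i => e (i + 1)) = e from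
        funext fun i => by cases i <;> rfl])
  | ex φ ih =>
    exact hS.bd_ex (Q := fun e a => M.Sat E φ (extend a e))
      (ih.congr fun e => by rw [show extend (e 0) (fun i => e (i + 1)) = e from
        funext fun i => by cases i <;> rfl])

theorem SigmaComprehension.modelsACA0 (hS : M.SigmaComprehension) : M.ModelsACA0 where
  basic := hM.out.basic
  induction X hX h0 hs n := bd_induction (p := fun n => n ∈ X) (.mem (.var 0) hX) h0 hs n
  comprehension φ E e := by
    refine ⟨{n | M.Sat E φ (extend n e)}, hM.out.bd_comprehension ?_, fun n => Iff.rfl⟩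
    let s : ℕ → (ℕ → M.Num) → M.Num := fun i => match i with
      | 0 => fun e' => e' 0
      | i + 1 => fun _ => e i
    refine ((hS.bd_sat φ E).subst (s := s) fun i => match i with
      | 0 => .var 0
      | i + 1 => .const (e i)).congr fun e' => ?_
    rw [show extend (e' 0) e = fun i => s i e' from funext fun i => by cases i <;> rfl]

/-! ## König's lemma -/

theorem SigmaComprehension.bd_extendible (hS : M.SigmaComprehension) {T : Set M.Num}
    (hT : T ∈ M.sets) {s : (ℕ → M.Num) → M.Num} (hs : Tm M s) :
    Bd M fun e => Extendible T (s e) :=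
  Bd.subst₁ (R := Extendible T) (.and (.mem (.var 0) hT) (hS.bd_all (hS.bd_ex (.and
    (.lt (.var 1) (.var 0)) (.and (.mem (.var 0) hT) (.isPrefix (.var 2) (.var 0))))))) hs

/-- `σ` is extendible in `T`, and no other extendible string branches off to the left of it. -/
def IsLeftmost (T : Set M.Num) (σ : M.Num) : Prop :=
  Extendible T σ ∧ ∀ ρ, Extendible T ρ → ∀ i,
    (∀ j, j < i → ∀ a, Entry σ j a ↔ Entry ρ j a) → ∀ a, Entry σ i a → ∀ b, Entry ρ i b → a ≤ b

theorem SigmaComprehension.bd_isLeftmost (hS : M.SigmaComprehension) {T : Set M.Num}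
    (hT : T ∈ M.sets) {s : (ℕ → M.Num) → M.Num} (hs : Tm M s) :
    Bd M fun e => IsLeftmost T (s e) :=
  Bd.subst₁ (R := IsLeftmost T) (.and (hS.bd_extendible hT (.var 0)) (hS.bd_all (.imp
    (hS.bd_extendible hT (.var 0)) (hS.bd_all (.imp
      (.ball (.var 0) (hS.bd_all (.iff (.entry (.var 4) (.var 1) (.var 0))
        (.entry (.var 3) (.var 1) (.var 0)))))
      (hS.bd_all (.imp (.entry (.var 3) (.var 1) (.var 0)) (hS.bd_all (.imp
        (.entry (.var 3) (.var 2) (.var 0)) (.le (.var 1) (.var 0)))))))))))  hs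

/-- A pigeonhole argument: if no successor were extendible, the extensions of `σ` through each of
the boundedly many next entries would be bounded, and collection would bound all proper extensions
at once. -/
theorem Extendible.exists_append (hS : M.SigmaComprehension) {T : Set M.Num} (hTs : T ∈ M.sets)
    (hT : IsTree T) (hfin : IsFinitelyBranching T) {σ l : M.Num} (hσ : Extendible T σ)
    (hl : IsStringOfLength σ l) : ∃ a τ, IsAppend σ a τ ∧ Extendible T τ := by
  by_contra! hno
  obtain ⟨b, hb⟩ := hfin σ hσ.1
  obtain ⟨C, hC⟩ := bd_collection
    (R := fun a c => ∀ τ, τ ∈ T → IsPrefix σ τ → Entry τ l a → τ ≤ c)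
    (hS.bd_all (.imp (.mem (.var 0) hTs) (.imp (.isPrefix (.const σ) (.var 0))
      (.imp (.entry (.var 0) (.const l) (.var 1)) (.le (.var 0) (.var 2)))))) b fun a _ => by
    obtain ⟨ρ, hρ, hp, ha⟩ := hl.exists_append a
    have hρτ : ∀ τ ∈ T, IsPrefix σ τ → Entry τ l a → IsPrefix ρ τ := by
      intro τ _ hστ hτa i c hc
      rcases (num_lt_succ _ _).1 (hc.lt_length hρ) with hi | rfl
      · exact hστ _ _ (hp.entry_of_lt hl hρ hi hc)
      · rwa [hc.unique hρ ha]
    by_cases hρT : ρ ∈ T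
    · have := hno a ρ ⟨l, hl, hρ, hp, ha⟩
      unfold Extendible at this
      push Not at this
      obtain ⟨c, hc⟩ := this hρT
      exact ⟨c, fun τ hτ hστ hτa => not_lt.1 fun h => hc τ h hτ (hρτ τ hτ hστ hτa)⟩
    · exact ⟨0, fun τ hτ hστ hτa => (hρT (hT.2 τ hτ ρ ⟨_, hρ⟩ (hρτ τ hτ hστ hτa))).elim⟩
  -- Exceeding `σ` as well rules out that `τ` is `σ` itself.
  obtain ⟨τ, hτ, hτT, hστ⟩ := hσ.2 (max C σ)
  obtain ⟨k, hk⟩ := hT.1 τ hτT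
  rcases (num_le_iff _ _).1 (hστ.length_le hl hk) with hlk | rfl
  · obtain ⟨a, ha⟩ := hk.exists_entry hlk
    obtain ⟨ρ, hρ, hp, hE⟩ := hk.exists_restrict (num_lt_iff_add_one_le.1 hlk)
    have hab : a < b := hb a ρ (hT.2 τ hτT ρ ⟨_, hρ⟩ hp) ⟨l, hl, hρ, fun i c hc =>
      (hE i c).2 ⟨(hc.lt_length hl).trans (num_lt_self_succ l), hστ i c hc⟩,
      (hE l a).2 ⟨num_lt_self_succ l, ha⟩⟩
    obtain ⟨c, hcC, hc⟩ := hC a hab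
    exact absurd ((le_max_left _ _).trans_lt hτ) (not_lt.2 ((hc τ hτT hστ ha).trans hcC.le))
  · rw [hl.ext hk hστ] at hτ
    exact absurd ((le_max_right _ _).trans_lt hτ) (lt_irrefl _)

theorem exists_isLeftmost (hS : M.SigmaComprehension) {T : Set M.Num} (hTs : T ∈ M.sets)
    (hT : IsTree T) (hinf : IsInfinite fun σ => σ ∈ T) (hfin : IsFinitelyBranching T) (l : M.Num) :
    ∃ σ, IsStringOfLength σ l ∧ IsLeftmost T σ := by
  refine bd_induction (p := fun l => ∃ σ, IsStringOfLength σ l ∧ IsLeftmost T σ)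
    (hS.bd_ex (.and (.isStringOfLength (.var 0) (.var 1)) (hS.bd_isLeftmost hTs (.var 0))))
    ?_ (fun l => ?_) l
  · obtain ⟨σ, hσ, _⟩ := exists_string (F := fun _ _ : M.Num => True) (.const M True) 0
      fun i hi => (num_not_lt_zero i hi).elim
    have hp : ∀ τ, IsPrefix σ τ := fun τ i a h => (num_not_lt_zero i (h.lt_length hσ)).elim
    obtain ⟨τ, _, hτ⟩ := hinf 0
    refine ⟨σ, hσ, ⟨hT.2 τ hτ σ ⟨_, hσ⟩ (hp τ), fun b => ?_⟩, fun ρ _ i _ a ha => ?_⟩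
    · obtain ⟨τ, hb, hτ⟩ := hinf b
      exact ⟨τ, hb, hτ, hp τ⟩
    · exact (num_not_lt_zero i (ha.lt_length hσ)).elim
  · rintro ⟨σ, hσ, hσe, hleft⟩
    obtain ⟨a₀, τ₀, ha₀, hτ₀⟩ := hσe.exists_append hS hTs hT hfin hσ
    -- The least next entry with an extendible successor; the condition is arithmetical, so a least
    -- one exists.
    obtain ⟨a, ⟨τ, hτa, hτ⟩, hmin⟩ := bd_exists_least
      (p := fun a => ∃ τ, (IsStringOfLength τ (l + 1) ∧ IsPrefix σ τ ∧ Entry τ l a) ∧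
        Extendible T τ)
      (hS.bd_ex (.and (.and (.isStringOfLength (.var 0) (.const _)) (.and
        (.isPrefix (.const σ) (.var 0)) (.entry (.var 0) (.const l) (.var 1))))
          (hS.bd_extendible hTs (.var 0))))
      ⟨τ₀, ha₀.entry hσ, hτ₀⟩
    obtain ⟨hτl, hp, ha⟩ := hτa
    refine ⟨τ, hτl, hτ, fun ρ hρ i hi c hc d hd => ?_⟩
    rcases (num_lt_succ _ _).1 (hc.lt_length hτl) with hil | rfl
    · refine hleft ρ hρ i (fun j hj a => ?_) c (hp.entry_of_lt hσ hτl hil hc) d hd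
      rw [← hi j hj a]
      exact ⟨hp j a, hp.entry_of_lt hσ hτl (hj.trans hil)⟩
    · rw [hc.unique hτl ha]
      -- As `ρ` agrees with all of `σ`, cutting it just after its next entry would give an
      -- extendible successor of `σ` with a smaller last entry.
      by_contra! hda
      obtain ⟨k, hk⟩ := hT.1 ρ hρ.1
      obtain ⟨π, hπ, hπρ, hE⟩ := hk.exists_restrict
        (num_lt_iff_add_one_le.1 (hd.lt_length hk))
      refine hmin d hda ⟨π, ⟨hπ, fun j x hx => ?_, (hE _ _).2 ⟨num_lt_self_succ _, hd⟩⟩,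
        hρ.of_isPrefix hT ⟨_, hπ⟩ hπρ⟩
      have hj := hx.lt_length hσ
      exact (hE j x).2 ⟨hj.trans (num_lt_self_succ _), (hi j hj x).1 (hp j x hx)⟩

/-- By strong induction the two strings agree below `i`; each being leftmost then compares the
entries at `i` in both directions. -/
theorem IsLeftmost.entry_unique {T : Set M.Num} (hT : IsTree T) {σ τ : M.Num}
    (hσ : IsLeftmost T σ) (hτ : IsLeftmost T τ) {i a b : M.Num} (ha : Entry σ i a)
    (hb : Entry τ i b) : a = b := by
  obtain ⟨k, hk⟩ := hT.1 σ hσ.1.1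
  obtain ⟨l, hl⟩ := hT.1 τ hτ.1.1
  have key : ∀ i, ∀ a, a < σ → ∀ b, b < τ → Entry σ i a → Entry τ i b → a = b := by
    refine bd_strong_induction (.ball (.const σ) (.ball (.const τ) (.imp
      (.entry (.const σ) (.var 2) (.var 1)) (.imp (.entry (.const τ) (.var 2) (.var 0))
        (.eq (.var 1) (.var 0)))))) fun i ih a _ b _ ha hb => ?_
    have hagree : ∀ j, j < i → ∀ c, Entry σ j c ↔ Entry τ j c := by
      intro j hj c
      obtain ⟨x, hx⟩ := hk.exists_entry (hj.trans (ha.lt_length hk))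
      obtain ⟨y, hy⟩ := hl.exists_entry (hj.trans (hb.lt_length hl))
      obtain rfl := ih j hj x hx.value_lt y hy.value_lt hx hy
      exact ⟨fun h => by rwa [h.unique hk hx], fun h => by rwa [h.unique hl hy]⟩
    exact le_antisymm (hσ.2 τ hτ.1 i hagree a ha b hb)
      (hτ.2 σ hσ.1 i (fun j hj c => (hagree j hj c).symm) b hb a ha)
  exact key i a ha.value_lt b hb.value_lt ha hb

/-- The union of the leftmost strings is a path. It is total because leftmost strings of every
length exist, and those same strings witness homogeneity. -/
theorem SigmaComprehension.modelsRKL (hS : M.SigmaComprehension) : M.ModelsRKL := by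
  intro T hTs hT hinf hfin
  have hleft := exists_isLeftmost hS hTs hT hinf hfin
  refine ⟨{x | ∃ σ, IsLeftmost T σ ∧ MemFin x σ},
    hM.out.bd_comprehension (hS.bd_ex (.and (hS.bd_isLeftmost hTs (.var 0))
      (.memFin (.var 1) (.var 0)))), {_n | True}, hM.out.bd_comprehension (.const M True),
    ⟨?_, ?_, fun n => ⟨fun _ => ?_, fun _ => trivial⟩⟩,
    fun b => ⟨b + 1, num_lt_self_succ b, trivial⟩, fun b => ?_⟩
  · rintro x ⟨σ, hσ, hx⟩
    obtain ⟨l, hl⟩ := hT.1 σ hσ.1.1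
    obtain ⟨n, a, h, _⟩ := hl.2.1 x hx
    exact ⟨n, a, h⟩
  · rintro n a b ⟨σ, hσ, ha⟩ ⟨τ, hτ, hb⟩
    exact hσ.entry_unique hT hτ ha hb
  · obtain ⟨σ, hl, hσ⟩ := hleft (n + 1)
    obtain ⟨a, ha⟩ := hl.exists_entry (num_lt_self_succ n)
    exact ⟨a, σ, hσ, ha⟩
  · obtain ⟨σ, hl, hσ⟩ := hleft (b + 1)
    refine ⟨σ, num_lt_iff_add_one_le.2 hl.length_le_self, hσ.1.1, ?_⟩
    rintro n a k ⟨τ, hτ, ha⟩ hk hn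
    obtain ⟨c, hc⟩ := hk.exists_entry hn
    rwa [← hσ.entry_unique hT hτ hc ha]

/-- Unboundedly many next entries would yield three distinct successors: each entry is chosen at
least as large as the preceding successor's code, and a code exceeds its entries, so the codes
increase. -/
theorem IsTwoBranching.isFinitelyBranching {T : Set M.Num} (hT : IsTwoBranching T) :
    IsFinitelyBranching T := by
  intro σ hσ
  by_contra! h
  have hlt : ∀ {a τ}, IsAppend σ a τ → a < τ := fun ⟨_, _, _, _, ha⟩ => ha.value_lt
  obtain ⟨a₁, τ₁, hτ₁, h₁, _⟩ := h 0
  obtain ⟨a₂, τ₂, hτ₂, h₂, h₁₂⟩ := h τ₁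
  obtain ⟨a₃, τ₃, hτ₃, h₃, h₂₃⟩ := h τ₂
  have l₁₂ := h₁₂.trans_lt (hlt h₂)
  have l₂₃ := h₂₃.trans_lt (hlt h₃)
  rcases hT σ hσ τ₁ hτ₁ τ₂ hτ₂ τ₃ hτ₃ ⟨_, h₁⟩ ⟨_, h₂⟩ ⟨_, h₃⟩ with h | h | h
  exacts [l₁₂.ne h, (l₁₂.trans l₂₃).ne h, l₂₃.ne h]

theorem ModelsRKL.modelsRKLTwoBranching (h : M.ModelsRKL) : M.ModelsRKLTwoBranching :=
  fun T hTs hT hinf htwo => h T hTs hT hinf htwo.isFinitelyBranching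

end ArithmeticalComprehension

end L2Structure

/-! ### The chain of implications -/

theorem mainTheorem8 (M : L2Structure.{u}) (hM : M.ModelsRCA0) :
    (M.ModelsACA0 ↔ M.ModelsRKL) ∧ (M.ModelsACA0 ↔ M.ModelsRKLTwoBranching) := by
  have : Fact M.ModelsRCA0 := ⟨hM⟩
  exact ⟨⟨fun h => h.sigmaComprehension.modelsRKL,
      fun h => h.modelsRKLTwoBranching.sigmaComprehension.modelsACA0⟩,
    ⟨fun h => h.sigmaComprehension.modelsRKL.modelsRKLTwoBranching,
      fun h => h.sigmaComprehension.modelsACA0⟩⟩
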